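/- Throughout, $T$ is a locally compact Hausdorff space with a bounded Radon measure $\mu$; $\mathfrak A\subseteq\mathbb B(\mathscr H)$ and $\mathfrak B\subseteq\mathbb B(\mathscr K)$ are norm closed $*$-algebras of bounded operators on complex Hilbert spaces that contain the identity operator $I$; $(\Phi_t)_{t\in T}:\mathfrak A\to\mathfrak B$ is a continuous field of positive linear maps (each $t\mapsto\Phi_t(X)$, $X\in\mathfrak A$, is norm continuous); and $(A_t)_{t\in T}$, $(B_t)_{t\in T}$ are norm continuous fields of self-adjoint operators in $\mathfrak A$. The functions $t\mapsto\Phi_t(I)$, $\Phi_t(A_t)$, $\Phi_t(B_t)$ are Bochner integrable, and $\int_T\Phi_t(I)\,d\mu(t)\le I$. An operator is strictly positive if it is positive and invertible. A continuous function $f:J\to\mathbb R$ on an interval $J$ is operator convex if $f(sX+(1-s)Y)\le sf(X)+(1-s)f(Y)$ for all $s\in[0,1]$ and all self-adjoint operators $X,Y$ with spectra in $J$ on any complex Hilbert space; $h$ is operator concave if $-h$ is operator convex. For $R$ strictly positive and $L$ self-adjoint such that $R^{-1/2}LR^{-1/2}$ has its spectrum in $J$, the perspective of $f$ is $$g(L,R)=R^{1/2}f\bigl(R^{-1/2}LR^{-1/2}\bigr)R^{1/2}.$$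 For $h:J'\to(0,\infty)$ continuous on an interval $J'$ and $R$ self-adjoint with spectrum in $J'$, put $$(f\Delta h)(L,R)=g(L,h(R))=h(R)^{1/2}f\bigl(h(R)^{-1/2}Lh(R)^{-1/2}\bigr)h(R)^{1/2},$$ whenever $h(R)^{-1/2}Lh(R)^{-1/2}$ has its spectrum in $J$. **Theorem 2.4.** Let $f$ be an operator convex function on an interval $J$ with $0\in J$ and $f(0)\le0$. (i) Let $h$ be an operator concave function on an interval $J'$ with $h>0$ on $J'$. Suppose that $(f\Delta h)(A_t,B_t)$ is defined for every $t$ and that $t\mapsto\Phi_t((f\Delta h)(A_t,B_t))$ is integrable. Suppose moreover that $0\in J'$, or $\int_T\Phi_t(I)\,d\mu(t)=I$, or $0$ is an endpoint of $J'$ and $\int_T\Phi_t(B_t)\,d\mu(t)$ has its spectrum in $J'$. Then the left-hand side below is defined and $$(f\Delta h)\left(\int_T\Phi_t(A_t)\,d\mu(t),\int_T\Phi_t(B_t)\,d\mu(t)\right)\le\int_T\Phi_t\bigl((f\Delta h)(A_t,B_t)\bigr)\,d\mu(t).$$ (ii) In particular, suppose that every $B_t$ is strictly positive, that $g(A_t,B_t)$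 is defined for every $t$, that $t\mapsto\Phi_t(g(A_t,B_t))$ is integrable, and that $\int_T\Phi_t(I)\,d\mu(t)=I$ or $\int_T\Phi_t(B_t)\,d\mu(t)$ is strictly positive. Then $\int_T\Phi_t(B_t)\,d\mu(t)$ is strictly positive, the left-hand side below is defined, and $$g\left(\int_T\Phi_t(A_t)\,d\mu(t),\int_T\Phi_t(B_t)\,d\mu(t)\right)\le\int_T\Phi_t\bigl(g(A_t,B_t)\bigr)\,d\mu(t).$$ -/

import Mathlib

open MeasureTheory

universe u

noncomputable section

/-- A continuous real function `f` on an interval `J` is operator convex if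
`f (s A + (1 - s) B) ≤ s f(A) + (1 - s) f(B)` for all self-adjoint bounded operators `A`, `B` with
spectra in `J`, on every complex Hilbert space, and all `s ∈ [0, 1]`. Here `f(A)` is the
continuous functional calculus and `≤` is the Loewner order. -/
def OperatorConvexOn (J : Set ℝ) (f : ℝ → ℝ) : Prop :=
  J.OrdConnected ∧ ContinuousOn f J ∧
    ∀ (H : Type u) [NormedAddCommGroup H] [InnerProductSpace ℂ H] [CompleteSpace H]
      (A B : H →L[ℂ] H), IsSelfAdjoint A → IsSelfAdjoint B →
      spectrum ℝ A ⊆ J → spectrum ℝ B ⊆ J → ∀ s ∈ Set.Icc (0 : ℝ) 1,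
        cfc f (s • A + (1 - s) • B) ≤ s • cfc f A + (1 - s) • cfc f B

/-- `h` is operator concave if `-h` is operator convex. -/
def OperatorConcaveOn (J : Set ℝ) (h : ℝ → ℝ) : Prop :=
  OperatorConvexOn.{u} J (fun x => -h x)

/-- The operator `R^{-1/2} L R^{-1/2}`, for strictly positive `R`. -/
def perspectiveArg {𝔄 : Type*} [CStarAlgebra 𝔄] (L R : 𝔄) : 𝔄 :=
  cfc (fun x : ℝ => (√x)⁻¹) R * L * cfc (fun x : ℝ => (√x)⁻¹) R

/-- The perspective `g(L, R) = R^{1/2} f(R^{-1/2} L R^{-1/2}) R^{1/2}` of `f`, for `R` strictly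
positive and `L` self-adjoint such that the spectrum of `R^{-1/2} L R^{-1/2}` lies in the domain
of `f`. -/
def operatorPerspective (f : ℝ → ℝ) {𝔄 : Type*} [CStarAlgebra 𝔄] (L R : 𝔄) : 𝔄 :=
  cfc Real.sqrt R * cfc f (perspectiveArg L R) * cfc Real.sqrt R

/-- The generalized perspective
`(f Δ h)(L, R) = h(R)^{1/2} f(h(R)^{-1/2} L h(R)^{-1/2}) h(R)^{1/2}`. -/
def generalizedPerspective (f h : ℝ → ℝ) {𝔄 : Type*} [CStarAlgebra 𝔄] (L R : 𝔄) : 𝔄 :=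
  operatorPerspective f L (cfc h R)

end

open Filter Topology

/-! ### Functional calculus on intervals -/

/-! Write `D = ∫ Φ_t(B_t)`, `Q = h(D)` and `R_t = h(B_t)`. Jensen's inequality for the concave `h`
gives `∫ Φ_t(R_t) ≤ Q`. Hence the positive maps `Ψ_t(Y) = Q^{-1/2} Φ_t(R_t^{1/2} Y R_t^{1/2})
Q^{-1/2}` have total mass at most 1. Jensen's inequality for `f`, applied to `Ψ_t` at `X_t =
R_t^{-1/2} A_t R_t^{-1/2}` with the missing mass placed at the node 0, where `f 0 ≤ 0`, is the claim
conjugated by `Q^{-1/2}`. The perspective inequality is the case `h(x) = x` on `(0, ∞)`.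

Everything thus rests on `OperatorConvexOn.jensen_integral`. The maps are only positive, not
completely positive, but they are applied only to functions of the single operator `X_t`. A
Bernstein partition of unity `b_k` with nodes `w_k` turns the integral into a finite sum `∑ w_k
E_k`, where the `E_k = ∫ Ψ_t(b_k(X_t))`, together with the missing mass, are positive operators of
sum 1. Dilating the `E_k` to orthogonal projections by an isometry reduces Jensen's inequality to
compression by an isometry, where a reflection and midpoint convexity suffice.

The spectra need not stay in one compact part of `J`, and `J` need not be closed. So the bounded
case is extended by exhausting `J`, and the spectrum of the integral is placed in `J` itself, not
just in its closure, by `spectrum_integral_add_subset`. -/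

theorem Set.OrdConnected.exists_Icc_superset {J S : Set ℝ} (hJ : J.OrdConnected)
    (hS : IsCompact S) (hSJ : S ⊆ J) : ∃ a b, S ⊆ Set.Icc a b ∧ Set.Icc a b ⊆ J := by
  rcases S.eq_empty_or_nonempty with rfl | hne
  · exact ⟨1, 0, by simp, by simp⟩
  · obtain ⟨a, ha⟩ := hS.exists_isLeast hne
    obtain ⟨b, hb⟩ := hS.exists_isGreatest hne
    exact ⟨a, b, fun x hx => ⟨ha.2 hx, hb.2 hx⟩, hJ.out (hSJ ha.1) (hSJ hb.1)⟩

/-- A compact subset of an interval has a relative neighbourhood inside a compact subinterval. -/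
theorem Set.OrdConnected.exists_isOpen_inter_subset_Icc {J S : Set ℝ} (hJ : J.OrdConnected)
    (hS : IsCompact S) (hSJ : S ⊆ J) :
    ∃ U a b, IsOpen U ∧ S ⊆ U ∧ U ∩ J ⊆ Set.Icc a b ∧ Set.Icc a b ⊆ J := by
  rcases S.eq_empty_or_nonempty with rfl | hne
  · exact ⟨∅, 1, 0, by simp⟩
  obtain ⟨a, ha⟩ := hS.exists_isLeast hne
  obtain ⟨b, hb⟩ := hS.exists_isGreatest hne
  have left : ∃ U c, IsOpen U ∧ S ⊆ U ∧ c ∈ J ∧ ∀ x ∈ U ∩ J, c ≤ x := by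
    by_cases h : ∃ y ∈ J, y < a
    · obtain ⟨y, hy, hya⟩ := h
      exact ⟨Set.Ioi y, y, isOpen_Ioi, fun x hx => hya.trans_le (ha.2 hx), hy, fun x hx => hx.1.le⟩
    · push Not at h
      exact ⟨Set.univ, a, isOpen_univ, Set.subset_univ _, hSJ ha.1, fun x hx => h x hx.2⟩
  have right : ∃ U c, IsOpen U ∧ S ⊆ U ∧ c ∈ J ∧ ∀ x ∈ U ∩ J, x ≤ c := by
    by_cases h : ∃ y ∈ J, b < y
    · obtain ⟨y, hy, hya⟩ := h
      exact ⟨Set.Iio y, y, isOpen_Iio, fun x hx => (hb.2 hx).trans_lt hya, hy,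
        fun x hx => le_of_lt hx.1⟩
    · push Not at h
      exact ⟨Set.univ, b, isOpen_univ, Set.subset_univ _, hSJ hb.1, fun x hx => h x hx.2⟩
  obtain ⟨U, c, hU, hSU, hc, hcU⟩ := left
  obtain ⟨V, d, hV, hSV, hd, hdV⟩ := right
  exact ⟨U ∩ V, c, d, hU.inter hV, Set.subset_inter hSU hSV,
    fun x hx => ⟨hcU x ⟨hx.1.1, hx.2⟩, hdV x ⟨hx.1.2, hx.2⟩⟩, hJ.out hc hd⟩

section CFC

variable {A : Type*} [CStarAlgebra A]

/-- The functional calculus of a function continuous on an interval `J` is norm continuous on the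
self-adjoint elements with spectrum in `J`. -/
theorem Filter.Tendsto.cfc_of_ordConnected {J : Set ℝ} (hJ : J.OrdConnected) {f : ℝ → ℝ}
    (hf : ContinuousOn f J) {X : Type*} {l : Filter X} {a : X → A} {a₀ : A}
    (ha : Tendsto a l (𝓝 a₀)) (hsa : ∀ x, IsSelfAdjoint (a x)) (hspec : ∀ x, spectrum ℝ (a x) ⊆ J)
    (hsa₀ : IsSelfAdjoint a₀) (hspec₀ : spectrum ℝ a₀ ⊆ J) :
    Tendsto (fun x => cfc f (a x)) l (𝓝 (cfc f a₀)) := by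
  obtain ⟨U, p, q, hU, hSU, hUJ, hpq⟩ :=
    hJ.exists_isOpen_inter_subset_Icc (spectrum.isCompact (𝕜 := ℝ) a₀) hspec₀
  have hev : ∀ᶠ y in 𝓝 a₀, spectrum ℝ y ⊆ U :=
    (upperHemicontinuous_spectrum ℝ A a₀ U (hU.mem_nhdsSet.2 hSU)).mono
      fun _ h => subset_of_mem_nhdsSet h
  exact ha.cfc isCompact_Icc f
    ((ha.eventually hev).mono fun x hx => (Set.subset_inter hx (hspec x)).trans hUJ)
    (.of_forall hsa) ((Set.subset_inter hSU hspec₀).trans hUJ) hsa₀ (hf.mono hpq)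

theorem Continuous.cfc_of_ordConnected {J : Set ℝ} (hJ : J.OrdConnected) {f : ℝ → ℝ}
    (hf : ContinuousOn f J) {X : Type*} [TopologicalSpace X] {a : X → A}
    (ha : Continuous a) (hsa : ∀ x, IsSelfAdjoint (a x)) (hspec : ∀ x, spectrum ℝ (a x) ⊆ J) :
    Continuous fun x => cfc f (a x) :=
  continuous_iff_continuousAt.2 fun x =>
    (ha.tendsto x).cfc_of_ordConnected hJ hf hsa hspec (hsa x) (hspec x)

variable [PartialOrder A] [StarOrderedRing A]

/-- Order bounds, unlike spectra, pass through conjugation, sums and positive maps. -/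
theorem IsSelfAdjoint.spectrum_subset_Icc_iff {a : A} (ha : IsSelfAdjoint a) {p q : ℝ} :
    spectrum ℝ a ⊆ Set.Icc p q ↔ p • 1 ≤ a ∧ a ≤ q • 1 := by
  rw [← Algebra.algebraMap_eq_smul_one, ← Algebra.algebraMap_eq_smul_one,
    algebraMap_le_iff_le_spectrum, le_algebraMap_iff_spectrum_le]
  exact ⟨fun h => ⟨fun x hx => (h hx).1, fun x hx => (h hx).2⟩, fun h x hx => ⟨h.1 x hx, h.2 x hx⟩⟩

theorem IsSelfAdjoint.notMem_spectrum_of_add_smul_le {a : A} (ha : IsSelfAdjoint a) {x δ : ℝ}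
    (hδ : 0 < δ) (h : (x + δ) • 1 ≤ a) : x ∉ spectrum ℝ a := by
  rw [← Algebra.algebraMap_eq_smul_one, algebraMap_le_iff_le_spectrum] at h
  intro hx
  linarith [h x hx]

theorem IsSelfAdjoint.isStrictlyPositive_iff_spectrum {a : A} (ha : IsSelfAdjoint a) :
    IsStrictlyPositive a ↔ spectrum ℝ a ⊆ Set.Ioi 0 := by
  rw [IsStrictlyPositive.iff_of_unital]
  constructor
  · rintro ⟨h0, hu⟩ x hx
    have h1 : 0 ≤ x := spectrum_nonneg_of_nonneg h0 hx
    refine lt_of_le_of_ne h1 ?_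
    rintro rfl
    exact (spectrum.zero_notMem_iff ℝ).2 hu hx
  · intro h
    refine ⟨?_, (spectrum.zero_notMem_iff ℝ).1 fun h0 => lt_irrefl (0 : ℝ) (h h0)⟩
    have := (algebraMap_le_iff_le_spectrum (R := ℝ) (r := 0) (a := a)).2 fun x hx => le_of_lt (h hx)
    simpa using this

end CFC

/-! ### The operator Jensen inequality for finitely many positive operators -/

section Hilbert

open ContinuousLinearMap InnerProductSpace

variable {H K : Type*} [NormedAddCommGroup H] [InnerProductSpace ℂ H] [CompleteSpace H]
  [NormedAddCommGroup K] [InnerProductSpace ℂ K] [CompleteSpace K]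

theorem ContinuousLinearMap.real_smul_comp {E F G : Type*} [NormedAddCommGroup E]
    [InnerProductSpace ℂ E] [NormedAddCommGroup F] [InnerProductSpace ℂ F] [NormedAddCommGroup G]
    [InnerProductSpace ℂ G] (r : ℝ) (X : F →L[ℂ] G) (Y : E →L[ℂ] F) :
    (r • X) ∘L Y = r • (X ∘L Y) := rfl

theorem ContinuousLinearMap.comp_real_smul {E F G : Type*} [NormedAddCommGroup E]
    [InnerProductSpace ℂ E] [NormedAddCommGroup F] [InnerProductSpace ℂ F] [NormedAddCommGroup G]
    [InnerProductSpace ℂ G] (r : ℝ) (X : F →L[ℂ] G) (Y : E →L[ℂ] F) :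
    X ∘L (r • Y) = r • (X ∘L Y) := by
  ext x
  exact X.map_smul_of_tower r (Y x)

theorem Polynomial.aeval_comp_eq_comp_aeval {H K : Type*} [NormedAddCommGroup H]
    [InnerProductSpace ℂ H] [NormedAddCommGroup K] [InnerProductSpace ℂ K] {Y : H →L[ℂ] H} {Z : K →L[ℂ] K} {V : K →L[ℂ] H}
    (h : Y ∘L V = V ∘L Z) (p : Polynomial ℝ) :
    Polynomial.aeval Y p ∘L V = V ∘L Polynomial.aeval Z p := by
  have hpow : ∀ n : ℕ, (Y ^ n) ∘L V = V ∘L Z ^ n := by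
    intro n
    induction n with
    | zero => rfl
    | succ n ih =>
      calc (Y ^ (n + 1)) ∘L V = (Y ^ n) ∘L (Y ∘L V) := by rw [pow_succ]; rfl
        _ = ((Y ^ n) ∘L V) ∘L Z := by rw [h]; rfl
        _ = V ∘L Z ^ (n + 1) := by rw [ih, pow_succ]; rfl
  induction p using Polynomial.induction_on' with
  | add p q hp hq => simp [hp, hq]
  | monomial n a =>
    simp only [Polynomial.aeval_monomial, Algebra.algebraMap_eq_smul_one, smul_mul_assoc, one_mul]
    rw [real_smul_comp, comp_real_smul, hpow]

/-- The functional calculus respects intertwining relations. -/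
theorem cfc_comp_eq_comp_cfc {J : Set ℝ} (hJ : J.OrdConnected) {f : ℝ → ℝ}
    (hf : ContinuousOn f J) {Y : H →L[ℂ] H} {Z : K →L[ℂ] K} {V : K →L[ℂ] H}
    (h : Y ∘L V = V ∘L Z) (hY : IsSelfAdjoint Y) (hZ : IsSelfAdjoint Z)
    (hYJ : spectrum ℝ Y ⊆ J) (hZJ : spectrum ℝ Z ⊆ J) : cfc f Y ∘L V = V ∘L cfc f Z := by
  obtain ⟨a, b, hS, hab⟩ := hJ.exists_Icc_superset
    ((spectrum.isCompact (𝕜 := ℝ) Y).union (spectrum.isCompact (𝕜 := ℝ) Z))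
    (Set.union_subset hYJ hZJ)
  -- Intertwining is exact for polynomials, so the defect is at most a uniform approximation error
  -- on each side of `V`.
  have key : ∀ ε > 0, ‖cfc f Y ∘L V - V ∘L cfc f Z‖ ≤ 2 * ε * ‖V‖ := by
    intro ε hε
    obtain ⟨p, hp⟩ := exists_polynomial_near_of_continuousOn a b f (hf.mono hab) ε hε
    have approx : ∀ {E : Type _} [NormedAddCommGroup E] [InnerProductSpace ℂ E] [CompleteSpace E]
        (X : E →L[ℂ] E), IsSelfAdjoint X → spectrum ℝ X ⊆ Set.Icc a b →
        ‖cfc f X - Polynomial.aeval X p‖ ≤ ε := by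
      intro E _ _ _ X hX hXs
      rw [← cfc_polynomial p X, ← cfc_sub f (fun x => p.eval x) X ((hf.mono hab).mono hXs)]
      refine norm_cfc_le hε.le fun x hx => ?_
      rw [Real.norm_eq_abs, abs_sub_comm]
      exact (hp x (hXs hx)).le
    have approx' : ‖cfc f Z - Polynomial.aeval Z p‖ ≤ ε := by
      rw [← cfc_polynomial p Z, ← cfc_sub f (fun x => p.eval x) Z
        ((hf.mono hab).mono (Set.subset_union_right.trans hS))]
      refine norm_cfc_le hε.le fun x hx => ?_
      rw [Real.norm_eq_abs, abs_sub_comm]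
      exact (hp x (hS (Or.inr hx))).le
    have e : cfc f Y ∘L V - V ∘L cfc f Z =
        (cfc f Y - Polynomial.aeval Y p) ∘L V - V ∘L (cfc f Z - Polynomial.aeval Z p) := by
      rw [sub_comp, comp_sub, Polynomial.aeval_comp_eq_comp_aeval h]
      abel
    rw [e]
    calc _ ≤ ‖(cfc f Y - Polynomial.aeval Y p) ∘L V‖ + ‖V ∘L (cfc f Z - Polynomial.aeval Z p)‖ :=
          norm_sub_le _ _
      _ ≤ ε * ‖V‖ + ‖V‖ * ε := by
          refine add_le_add ((opNorm_comp_le _ _).trans ?_) ((opNorm_comp_le _ _).trans ?_)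
          · exact mul_le_mul_of_nonneg_right
              (approx Y hY (Set.subset_union_left.trans hS)) (norm_nonneg _)
          · exact mul_le_mul_of_nonneg_left approx' (norm_nonneg _)
      _ = 2 * ε * ‖V‖ := by ring
  rw [← sub_eq_zero, ← norm_le_zero_iff]
  have lim : Tendsto (fun ε : ℝ => 2 * ε * ‖V‖) (𝓝[>] 0) (𝓝 0) := by
    have : Continuous fun ε : ℝ => 2 * ε * ‖V‖ := by fun_prop
    simpa using (this.tendsto 0).mono_left nhdsWithin_le_nhds
  exact ge_of_tendsto lim (eventually_mem_nhdsWithin.mono fun ε hε => key ε hε)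

theorem ContinuousLinearMap.adjoint_conj_mono (V : K →L[ℂ] H) {X Y : H →L[ℂ] H} (h : X ≤ Y) :
    adjoint V ∘L X ∘L V ≤ adjoint V ∘L Y ∘L V := by
  rw [ContinuousLinearMap.le_def] at h ⊢
  simpa only [sub_comp, comp_sub] using h.adjoint_conj V

theorem IsSelfAdjoint.sum_smul {A ι : Type*} [CStarAlgebra A] {s : Finset ι} {E : ι → A}
    (hE : ∀ i, IsSelfAdjoint (E i)) (w : ι → ℝ) : IsSelfAdjoint (∑ i ∈ s, w i • E i) :=
  isSelfAdjoint_sum _ fun i _ => (IsSelfAdjoint.all (w i)).smul (hE i)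

theorem spectrum_sum_smul_subset {A ι : Type*} [CStarAlgebra A] [PartialOrder A] [StarOrderedRing A]
    [Fintype ι] {J : Set ℝ} (hJ : J.OrdConnected) {E : ι → A} (hE : ∀ i, 0 ≤ E i)
    (hsum : ∑ i, E i = 1) {w : ι → ℝ} (hw : ∀ i, w i ∈ J) :
    spectrum ℝ (∑ i, w i • E i) ⊆ J := by
  obtain ⟨a, b, hS, hab⟩ := hJ.exists_Icc_superset (Set.finite_range w).isCompact
    (Set.range_subset_iff.2 hw)
  refine ((IsSelfAdjoint.sum_smul (fun i => (hE i).isSelfAdjoint) w).spectrum_subset_Icc_iff.2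
    ?_).trans hab
  rw [← hsum, Finset.smul_sum, Finset.smul_sum]
  exact ⟨Finset.sum_le_sum fun i _ => smul_le_smul_of_nonneg_right (hS ⟨i, rfl⟩).1 (hE i),
    Finset.sum_le_sum fun i _ => smul_le_smul_of_nonneg_right (hS ⟨i, rfl⟩).2 (hE i)⟩

/-- Jensen's operator inequality for an isometry. -/
theorem OperatorConvexOn.cfc_adjoint_conj_le {H K : Type u} [NormedAddCommGroup H]
    [InnerProductSpace ℂ H] [CompleteSpace H] [NormedAddCommGroup K] [InnerProductSpace ℂ K]
    [CompleteSpace K] {J : Set ℝ} {f : ℝ → ℝ} (hf : OperatorConvexOn.{u} J f)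
    {V : K →L[ℂ] H} (hV : adjoint V ∘L V = 1) {D : H →L[ℂ] H} (hD : IsSelfAdjoint D)
    (hDJ : spectrum ℝ D ⊆ J) :
    cfc f (adjoint V ∘L D ∘L V) ≤ adjoint V ∘L cfc f D ∘L V := by
  obtain ⟨hJ, hfc, hconv⟩ := hf
  obtain ⟨a, b, hS, hab⟩ := hJ.exists_Icc_superset (spectrum.isCompact (𝕜 := ℝ) D) hDJ
  obtain ⟨ha, hb⟩ := hD.spectrum_subset_Icc_iff.1 hS
  set P : H →L[ℂ] H := V ∘L adjoint V with hP
  have hPsa : IsSelfAdjoint P := by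
    rw [ContinuousLinearMap.isSelfAdjoint_iff', hP, adjoint_comp, adjoint_adjoint]
  have hVP : adjoint V ∘L P = adjoint V := by rw [hP, ← comp_assoc, hV]; rfl
  have hPV : P ∘L V = V := by rw [hP, comp_assoc, hV]; rfl
  have hPP : P * P = P := by
    change (V ∘L adjoint V) ∘L P = P
    rw [comp_assoc, hVP]
  -- The reflection `2VV* - 1` fixes the range of `V` and negates its complement. The average `Y` of
  -- `D` and `UDU` is the block-diagonal part of `D`: it has the same compression as `D`, and the
  -- range of `V` reduces it, so `f` commutes with compressing `Y`.
  set U : H →L[ℂ] H := P + P - 1 with hU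
  have hUsa : IsSelfAdjoint U := by
    exact (hPsa.add hPsa).sub (.one _)
  have hUU : U * U = 1 := by
    simp only [hU, mul_sub, sub_mul, mul_add, add_mul, hPP, mul_one, one_mul]
    abel
  have hUV : U ∘L V = V := by
    rw [hU, sub_comp, add_comp, hPV]
    exact add_sub_cancel_right _ _
  have hVU : adjoint V ∘L U = adjoint V := by
    have := congrArg adjoint hUV
    rwa [adjoint_comp, ← star_eq_adjoint U, hUsa.star_eq] at this
  set D' := U * D * U with hD'
  have hD'sa : IsSelfAdjoint D' := by
    have := hD.conjugate U
    rwa [hUsa.star_eq] at this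
  have hconj1 : ∀ r : ℝ, U * (r • 1) * U = r • 1 := by
    intro r
    rw [mul_smul_comm, smul_mul_assoc, mul_one, hUU]
  have hD'S : spectrum ℝ D' ⊆ Set.Icc a b := by
    rw [hD'sa.spectrum_subset_Icc_iff, ← hconj1 a, ← hconj1 b]
    exact ⟨hUsa.conjugate_le_conjugate ha, hUsa.conjugate_le_conjugate hb⟩
  have hfD' : cfc f D' = U * cfc f D * U := by
    have hint : D' ∘L U = U ∘L D := by
      change U * D * U * U = U * D
      rw [mul_assoc, hUU, mul_one]
    have := cfc_comp_eq_comp_cfc hJ hfc hint hD'sa hD (hD'S.trans hab) hDJ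
    change cfc f D' * U = U * cfc f D at this
    rw [← this, mul_assoc, hUU, mul_one]
  have hmid := hconv H D D' hD hD'sa hDJ (hD'S.trans hab) (1 / 2) ⟨by norm_num, by norm_num⟩
  rw [show (1 : ℝ) - 1 / 2 = 1 / 2 by norm_num] at hmid
  set Y : H →L[ℂ] H := (1 / 2 : ℝ) • D + (1 / 2 : ℝ) • D' with hY
  have hYsa : IsSelfAdjoint Y :=
    ((IsSelfAdjoint.all _).smul hD).add ((IsSelfAdjoint.all _).smul hD'sa)
  have hhalf : ∀ {E : Type u} [NormedAddCommGroup E] [InnerProductSpace ℂ E] (X : E →L[ℂ] E),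
      (1 / 2 : ℝ) • X + (1 / 2 : ℝ) • X = X := by
    intro E _ _ X
    rw [← add_smul]; norm_num
  have hYJ : spectrum ℝ Y ⊆ J := by
    refine (hYsa.spectrum_subset_Icc_iff.2 ?_).trans hab
    obtain ⟨ha', hb'⟩ := hD'sa.spectrum_subset_Icc_iff.1 hD'S
    rw [← hhalf (a • 1), ← hhalf (b • 1)]
    exact ⟨add_le_add (smul_le_smul_of_nonneg_left ha (by norm_num))
        (smul_le_smul_of_nonneg_left ha' (by norm_num)),
      add_le_add (smul_le_smul_of_nonneg_left hb (by norm_num))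
        (smul_le_smul_of_nonneg_left hb' (by norm_num))⟩
  have hcomp : ∀ X : H →L[ℂ] H, adjoint V ∘L (U * X * U) ∘L V = adjoint V ∘L X ∘L V := by
    intro X
    change (adjoint V ∘L U) ∘L X ∘L (U ∘L V) = _
    rw [hVU, hUV]
  have hVYV : adjoint V ∘L Y ∘L V = adjoint V ∘L D ∘L V := by
    rw [hY, add_comp, comp_add, real_smul_comp, comp_real_smul, real_smul_comp, comp_real_smul, hD', hcomp, hhalf]
  have hUYU : U * Y = Y * U := by
    rw [hY, mul_add, add_mul, hD', mul_smul_comm, mul_smul_comm, smul_mul_assoc, smul_mul_assoc,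
      ← mul_assoc, ← mul_assoc, hUU, one_mul, mul_assoc (U * D), hUU, mul_one, add_comm]
  have hPY : P * Y = Y * P := by
    have e : P = (1 / 2 : ℝ) • (U + 1) := by
      rw [hU, sub_add_cancel, smul_add, hhalf]
    rw [e, smul_mul_assoc, mul_smul_comm, add_mul, hUYU, one_mul]
    congr 1
    rw [mul_add, mul_one]
  have hint : Y ∘L V = V ∘L (adjoint V ∘L Y ∘L V) := by
    calc Y ∘L V = Y ∘L (P ∘L V) := by rw [hPV]
      _ = (Y * P) ∘L V := rfl
      _ = (P * Y) ∘L V := by rw [hPY]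
      _ = _ := rfl
  have hZsa : IsSelfAdjoint (adjoint V ∘L Y ∘L V) := hYsa.adjoint_conj V
  have hZJ : spectrum ℝ (adjoint V ∘L Y ∘L V) ⊆ J := by
    refine (hZsa.spectrum_subset_Icc_iff.2 ?_).trans hab
    have hr : ∀ r : ℝ, adjoint V ∘L (r • 1 : H →L[ℂ] H) ∘L V = r • 1 := by
      intro r
      rw [real_smul_comp, comp_real_smul]
      congr 1
    rw [hVYV, ← hr a, ← hr b]
    exact ⟨adjoint_conj_mono V ha, adjoint_conj_mono V hb⟩
  have hfY : cfc f (adjoint V ∘L Y ∘L V) = adjoint V ∘L cfc f Y ∘L V := by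
    rw [cfc_comp_eq_comp_cfc hJ hfc hint hYsa hZsa hYJ hZJ]
    change _ = (adjoint V ∘L V) ∘L _
    rw [hV]; rfl
  rw [← hVYV, hfY]
  refine (adjoint_conj_mono V hmid).trans_eq ?_
  rw [add_comp, comp_add, real_smul_comp, comp_real_smul, real_smul_comp, comp_real_smul, hfD', hcomp, hhalf]

/-- Naimark dilation: `V = ∑ I_i E_i^{1/2}` is an isometry that compresses the orthogonal
projections `I_i I_i*` to the `E_i`. It therefore compresses the diagonal operators with entries
`w_i` and `f (w_i)` to the two sums, and the isometric Jensen inequality applies. -/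
theorem OperatorConvexOn.cfc_sum_smul_le_of_isometries {K M : Type u} [NormedAddCommGroup K]
    [InnerProductSpace ℂ K] [CompleteSpace K] [NormedAddCommGroup M] [InnerProductSpace ℂ M]
    [CompleteSpace M] {J : Set ℝ} {f : ℝ → ℝ} (hf : OperatorConvexOn.{u} J f) {ι : Type*}
    [Fintype ι] [DecidableEq ι] (I : ι → K →L[ℂ] M)
    (hI : ∀ i j, adjoint (I i) ∘L I j = if i = j then 1 else 0)
    (hI1 : ∑ i, I i ∘L adjoint (I i) = 1) {E : ι → K →L[ℂ] K}
    (hE : ∀ i, 0 ≤ E i) (hsum : ∑ i, E i = 1) {w : ι → ℝ} (hw : ∀ i, w i ∈ J) :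
    cfc f (∑ i, w i • E i) ≤ ∑ i, f (w i) • E i := by
  let S : ι → K →L[ℂ] K := fun i => CFC.sqrt (E i)
  have hSsa : ∀ i, adjoint (S i) = S i := fun i =>
    (CFC.sqrt_nonneg (E i)).isSelfAdjoint
  have hSS : ∀ i, S i ∘L S i = E i := fun i => CFC.sqrt_mul_sqrt_self (E i) (hE i)
  let V : K →L[ℂ] M := ∑ i, I i ∘L S i
  have hIV : ∀ i, adjoint (I i) ∘L V = S i := by
    intro i
    simp only [V, comp_finsetSum, ← comp_assoc, hI]
    rw [Finset.sum_eq_single i]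
    · rw [if_pos rfl]; rfl
    · intro j _ hj
      rw [if_neg hj.symm, zero_comp]
    · simp
  have hVI : ∀ i, adjoint V ∘L I i = S i := by
    intro i
    have := congrArg adjoint (hIV i)
    rwa [adjoint_comp, adjoint_adjoint, hSsa] at this
  have hconj : ∀ c : ι → ℝ,
      adjoint V ∘L (∑ i, c i • (I i ∘L adjoint (I i))) ∘L V = ∑ i, c i • E i := by
    intro c
    rw [finsetSum_comp, comp_finsetSum]
    refine Finset.sum_congr rfl fun i _ => ?_
    rw [real_smul_comp, comp_real_smul]
    congr 1
    calc adjoint V ∘L (I i ∘L adjoint (I i)) ∘L V = (adjoint V ∘L I i) ∘L (adjoint (I i) ∘L V) := rfl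
      _ = E i := by rw [hVI, hIV, hSS]
  have hV : adjoint V ∘L V = 1 := by
    have := hconj fun _ => 1
    simp only [one_smul, hI1, hsum] at this
    exact this
  have hpos : ∀ i, 0 ≤ I i ∘L adjoint (I i) := fun i => by
    rw [ContinuousLinearMap.nonneg_iff_isPositive]
    exact ContinuousLinearMap.isPositive_self_comp_adjoint _
  set D : M →L[ℂ] M :=
    ∑ i, w i • (I i ∘L adjoint (I i)) with hDdef
  have hD : IsSelfAdjoint D := IsSelfAdjoint.sum_smul (fun i => (hpos i).isSelfAdjoint) w
  have hDJ : spectrum ℝ D ⊆ J := spectrum_sum_smul_subset hf.1 hpos hI1 hw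
  -- `I i` intertwines `D` with the scalar `w i`, hence `f(D)` with `f (w i)`.
  have hDI : ∀ i, cfc f D ∘L I i = f (w i) • I i := by
    intro i
    rcases subsingleton_or_nontrivial K with hK | hK
    · ext x
      rw [Subsingleton.elim x 0]; simp
    have hint : D ∘L I i = I i ∘L (algebraMap ℝ (K →L[ℂ] K) (w i)) := by
      rw [hDdef, finsetSum_comp, Finset.sum_eq_single i]
      · rw [real_smul_comp, comp_assoc, hI, if_pos rfl, Algebra.algebraMap_eq_smul_one, comp_real_smul]
      · intro j _ hj
        rw [real_smul_comp, comp_assoc, hI, if_neg hj, comp_zero]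
        exact smul_zero (w j)
      · simp
    rw [cfc_comp_eq_comp_cfc hf.1 hf.2.1 hint hD (IsSelfAdjoint.algebraMap _ (.all _)) hDJ
      (by rw [spectrum.scalar_eq]; simpa using hw i), cfc_algebraMap,
      Algebra.algebraMap_eq_smul_one, comp_real_smul]
    rfl
  have hfD : cfc f D = ∑ i, f (w i) • (I i ∘L adjoint (I i)) := by
    calc cfc f D = cfc f D ∘L (∑ i, I i ∘L adjoint (I i)) := by rw [hI1]; rfl
      _ = _ := by
        rw [comp_finsetSum]
        refine Finset.sum_congr rfl fun i _ => ?_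
        rw [← comp_assoc, hDI, real_smul_comp]
  have := hf.cfc_adjoint_conj_le hV hD hDJ
  rwa [hfD, hconj, hconj] at this

/-- The inclusion of the `i`-th summand in a finite Hilbert sum of copies of `K`. -/
noncomputable def PiLp.inclusion (K : Type*) [NormedAddCommGroup K] [InnerProductSpace ℂ K]
    {ι : Type*} [Fintype ι] [DecidableEq ι] (i : ι) : K →L[ℂ] PiLp 2 fun _ : ι => K :=
  (PiLp.continuousLinearEquiv 2 ℂ fun _ : ι => K).symm.toContinuousLinearMap ∘L
    ContinuousLinearMap.single ℂ (fun _ : ι => K) i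

theorem PiLp.adjoint_inclusion {ι : Type*} [Fintype ι] [DecidableEq ι] (i : ι) :
    adjoint (PiLp.inclusion K i) = PiLp.proj 2 (fun _ : ι => K) i := by
  symm
  rw [ContinuousLinearMap.eq_adjoint_iff]
  intro x y
  rw [PiLp.inner_apply, Finset.sum_eq_single i]
  · simp [PiLp.inclusion]
  · intro j _ hj
    simp [PiLp.inclusion, hj]
  · simp

/-- **Jensen's operator inequality** for a finite resolution of the identity by positive operators
and scalar nodes. -/
theorem OperatorConvexOn.cfc_sum_smul_le {K : Type u} [NormedAddCommGroup K]
    [InnerProductSpace ℂ K] [CompleteSpace K] {J : Set ℝ} {f : ℝ → ℝ}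
    (hf : OperatorConvexOn.{u} J f) {ι : Type} [Fintype ι] {E : ι → K →L[ℂ] K}
    (hE : ∀ i, 0 ≤ E i) (hsum : ∑ i, E i = 1) {w : ι → ℝ} (hw : ∀ i, w i ∈ J) :
    cfc f (∑ i, w i • E i) ≤ ∑ i, f (w i) • E i := by
  classical
  let I : ι → K →L[ℂ] PiLp 2 fun _ : ι => K := PiLp.inclusion K
  have hI : ∀ i j, adjoint (I i) ∘L I j = if i = j then 1 else 0 := by
    intro i j
    rw [PiLp.adjoint_inclusion]
    ext x
    by_cases h : i = j
    · subst h; simp [I, PiLp.inclusion]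
    · simp [I, PiLp.inclusion, h]
  have hI1 : ∑ i, I i ∘L adjoint (I i) = 1 := by
    simp only [I, PiLp.adjoint_inclusion]
    ext x j
    simp [PiLp.inclusion, Finset.sum_apply, Pi.single_apply]
  exact hf.cfc_sum_smul_le_of_isometries I hI hI1 hE hsum hw

end Hilbert

/-! ### The operator Jensen inequality for integrals of positive maps -/

theorem exists_monotone_Icc_exhaustion {J : Set ℝ} (hJ : J.OrdConnected) {w : ℝ} (hw : w ∈ J) :
    ∃ p q : ℕ → ℝ, Antitone p ∧ Monotone q ∧ (∀ n, p n ∈ J ∧ q n ∈ J ∧ p n ≤ w ∧ w ≤ q n) ∧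
      ∀ x ∈ J, ∀ᶠ n in atTop, p n ≤ x ∧ x ≤ q n := by
  have : Nonempty J := ⟨⟨w, hw⟩⟩
  -- The limits are taken in the order `J` itself, so an endpoint belonging to `J` is eventually
  -- reached and not merely approached.
  obtain ⟨p, hpa, hp⟩ := exists_seq_antitone_tendsto_atTop_atBot J
  obtain ⟨q, hqm, hq⟩ := exists_seq_monotone_tendsto_atTop_atTop J
  have hmin : ∀ x y, x ∈ J → y ∈ J → min x y ∈ J := fun x y hx hy => by
    rcases min_choice x y with h | h <;> rwa [h]
  have hmax : ∀ x y, x ∈ J → y ∈ J → max x y ∈ J := fun x y hx hy => by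
    rcases max_choice x y with h | h <;> rwa [h]
  refine ⟨fun n => min (p n) w, fun n => max (q n) w,
    fun m n h => min_le_min_right _ (hpa h), fun m n h => max_le_max_right _ (hqm h),
    fun n => ⟨hmin _ _ (p n).2 hw, hmax _ _ (q n).2 hw, min_le_right _ _, le_max_right _ _⟩, ?_⟩
  intro x hx
  filter_upwards [hp.eventually (eventually_le_atBot ⟨x, hx⟩),
    hq.eventually (eventually_ge_atTop ⟨x, hx⟩)] with n h1 h2
  exact ⟨(min_le_left _ _).trans h1, le_trans h2 (le_max_left _ _)⟩

/-- Approximation by Bernstein polynomials, as a continuous partition of unity with nodes that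
reproduces the identity function exactly. -/
theorem exists_partition_nodes {p q : ℝ} (hpq : p ≤ q) {f : ℝ → ℝ}
    (hf : ContinuousOn f (Set.Icc p q)) {ε : ℝ} (hε : 0 < ε) :
    ∃ (n : ℕ) (w : Fin n → ℝ) (b : Fin n → ℝ → ℝ), (∀ k, w k ∈ Set.Icc p q) ∧
      (∀ k, Continuous (b k)) ∧ ∀ x ∈ Set.Icc p q, (∀ k, 0 ≤ b k x) ∧ ∑ k, b k x = 1 ∧
        ∑ k, w k * b k x = x ∧ ∑ k, f (w k) * b k x ≤ f x + ε := by
  have hmem : ∀ s : unitInterval, p + s * (q - p) ∈ Set.Icc p q := fun s =>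
    ⟨by nlinarith [s.2.1], by nlinarith [s.2.2]⟩
  let F : C(unitInterval, ℝ) := ⟨fun s => f (p + s * (q - p)),
    hf.comp_continuous (by fun_prop) hmem⟩
  obtain ⟨N, hN⟩ := Metric.tendsto_atTop.1 (bernsteinApproximation_uniform F) ε hε
  -- A positive degree, so that the nodes `k / n` do not divide by zero.
  set n := N + 1
  refine ⟨n + 1, fun k => p + bernstein.z k * (q - p),
    fun k x => (bernsteinPolynomial ℝ n k).eval ((x - p) / (q - p)), fun k => hmem _,
    fun k => (Polynomial.continuous _).comp (by fun_prop), ?_⟩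
  intro x hx
  obtain ⟨s, hs⟩ : ∃ s : unitInterval, (s : ℝ) = (x - p) / (q - p) :=
    ⟨⟨_, div_nonneg (by linarith [hx.1]) (by linarith),
      div_le_one_of_le₀ (by linarith [hx.2]) (by linarith)⟩, rfl⟩
  have hxs : x = p + s * (q - p) := by
    rw [hs]
    -- If `p = q`, the quotient defining `s` is 0 by convention, which still represents the only
    -- point `x = p`.
    rcases hpq.eq_or_lt with rfl | h
    · simpa using le_antisymm hx.2 hx.1
    · have : q - p ≠ 0 := by linarith
      field_simp; ring
  have hb : ∀ k : Fin (n + 1),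
      (bernsteinPolynomial ℝ n k).eval ((x - p) / (q - p)) = bernstein n k s := fun k => by
    rw [← hs]; rfl
  simp only [hb]
  have h1 := bernstein.probability n s
  have hid : ∑ k : Fin (n + 1), (bernstein.z k : ℝ) * bernstein n k s = s := by
    have := congrArg (Polynomial.eval (s : ℝ)) (bernsteinPolynomial.sum_smul ℝ n)
    simp only [Polynomial.eval_finsetSum, nsmul_eq_mul, Polynomial.eval_mul,
      Polynomial.eval_natCast, Polynomial.eval_X, Finset.sum_range] at this
    have hn : (n : ℝ) ≠ 0 := Nat.cast_ne_zero.2 (Nat.succ_ne_zero N)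
    rw [← mul_right_inj' hn, ← this, Finset.mul_sum]
    refine Finset.sum_congr rfl fun k _ => ?_
    rw [← mul_assoc]
    congr 1
    simp only [bernstein.z]
    field_simp
  refine ⟨fun k => bernstein_nonneg, h1, ?_, ?_⟩
  · simp only [add_mul, Finset.sum_add_distrib, ← Finset.mul_sum, h1, mul_right_comm _ (q - p),
      ← Finset.sum_mul, hid]
    rw [mul_one, ← hxs]
  · have h2 := (ContinuousMap.dist_apply_le_dist (f := bernsteinApproximation n F) (g := F) s).trans_lt
      (hN n (Nat.le_succ N))
    rw [Real.dist_eq, bernsteinApproximation.apply] at h2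
    have h3 := (abs_lt.1 h2).2
    have h4 : F s = f x := by rw [hxs]; rfl
    rw [h4] at h3
    have h5 : ∑ k : Fin (n + 1), bernstein n k s • F (bernstein.z k) =
        ∑ k : Fin (n + 1), f (p + bernstein.z k * (q - p)) * bernstein n k s :=
      Finset.sum_congr rfl fun k _ => mul_comm _ _
    rw [h5] at h3
    linarith

section Integral

variable {T : Type*} [MeasurableSpace T] {μ : Measure T}
  {A B : Type*} [CStarAlgebra A] [PartialOrder A] [StarOrderedRing A]
  [CStarAlgebra B] [PartialOrder B] [StarOrderedRing B]

theorem MeasureTheory.isSelfAdjoint_integral {B : Type*} [CStarAlgebra B] {g : T → B}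
    (hg : ∀ t, IsSelfAdjoint (g t)) :
    IsSelfAdjoint (∫ t, g t ∂μ) := by
  change star (∫ t, g t ∂μ) = _
  have := ((starL' ℝ : B ≃L[ℝ] B)).integral_comp_comm (μ := μ) g
  calc star (∫ t, g t ∂μ) = ∫ t, star (g t) ∂μ := this.symm
    _ = ∫ t, g t ∂μ := by simp only [(hg _).star_eq]

theorem cfc_sum_mul {n : ℕ} (c : Fin n → ℝ) (b : Fin n → ℝ → ℝ) (hb : ∀ k, Continuous (b k))
    {A : Type*} [CStarAlgebra A] (a : A) :
    cfc (fun x => ∑ k, c k * b k x) a = ∑ k, c k • cfc (b k) a := by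
  have := cfc_sum_univ (fun k x => c k * b k x) a
    fun k => (continuous_const.mul (hb k)).continuousOn
  rw [Finset.sum_fn] at this
  rw [this]
  exact Finset.sum_congr rfl fun k _ => cfc_const_mul _ _ _ (hb k).continuousOn

theorem PositiveLinearMap.norm_apply_cfc_le (Ψ : A →ₚ[ℂ] B) {b : ℝ → ℝ} (a : A)
    (hb0 : ∀ x ∈ spectrum ℝ a, 0 ≤ b x) (hb1 : ∀ x ∈ spectrum ℝ a, b x ≤ 1) :
    ‖Ψ (cfc b a)‖ ≤ ‖Ψ 1‖ := by
  refine (Ψ.norm_apply_le_of_nonneg _ (cfc_nonneg hb0)).trans ?_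
  refine mul_le_of_le_one_right (norm_nonneg _) (norm_cfc_le zero_le_one fun x hx => ?_)
  rw [Real.norm_of_nonneg (hb0 x hx)]
  exact hb1 x hx

variable [TopologicalSpace T]

/-- The partition reproduces the identity function exactly, so `∑ w_k E_k` is the integral itself.
Only the values of `f` are approximated, at a cost of `ε • ∫ Ψ_t(1)`, which vanishes in the limit.
-/
theorem OperatorConvexOn.jensen_integral_of_bounded {K : Type u} [NormedAddCommGroup K]
    [InnerProductSpace ℂ K] [CompleteSpace K] {J : Set ℝ} {f : ℝ → ℝ}
    (hf : OperatorConvexOn.{u} J f) {Ψ : T → A →ₚ[ℂ] (K →L[ℂ] K)}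
    (hmeas : ∀ Y : T → A, Continuous Y → AEStronglyMeasurable (fun t => Ψ t (Y t)) μ)
    (h1 : Integrable (fun t => Ψ t 1) μ) {X : T → A} (hX : Continuous X)
    (hXsa : ∀ t, IsSelfAdjoint (X t)) {p q : ℝ} (hpq : p ≤ q) (hpqJ : Set.Icc p q ⊆ J)
    (hXpq : ∀ᵐ t ∂μ, spectrum ℝ (X t) ⊆ Set.Icc p q)
    (hfX : Integrable (fun t => Ψ t (cfc f (X t))) μ) {P : K →L[ℂ] K} (hP : 0 ≤ P)
    (hsum : ∫ t, Ψ t 1 ∂μ + P = 1) {w : ℝ} (hw : w ∈ J) :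
    spectrum ℝ (∫ t, Ψ t (X t) ∂μ + w • P) ⊆ J ∧
      cfc f (∫ t, Ψ t (X t) ∂μ + w • P) ≤ ∫ t, Ψ t (cfc f (X t)) ∂μ + f w • P := by
  have key : ∀ ε > (0 : ℝ), spectrum ℝ (∫ t, Ψ t (X t) ∂μ + w • P) ⊆ J ∧
      cfc f (∫ t, Ψ t (X t) ∂μ + w • P) ≤
        ∫ t, Ψ t (cfc f (X t)) ∂μ + f w • P + ε • ∫ t, Ψ t 1 ∂μ := by
    intro ε hε
    have hfc := hf.2.1.mono hpqJ
    obtain ⟨n, v, b, hv, hbc, hb⟩ := exists_partition_nodes hpq hfc hε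
    have hint : ∀ k, Integrable (fun t => Ψ t (cfc (b k) (X t))) μ := fun k => by
      refine h1.mono (hmeas _ (hX.cfc_of_ordConnected Set.ordConnected_univ
        (hbc k).continuousOn hXsa fun t => Set.subset_univ _)) (hXpq.mono fun t ht => ?_)
      refine (Ψ t).norm_apply_cfc_le _ (fun x hx => (hb x (ht hx)).1 k) fun x hx => ?_
      obtain ⟨h0, hs, -⟩ := hb x (ht hx)
      rw [← hs]
      exact Finset.single_le_sum (fun i _ => h0 i) (Finset.mem_univ k)
    have hsumint : ∀ c : Fin n → ℝ, ∑ k, c k • ∫ t, Ψ t (cfc (b k) (X t)) ∂μ =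
        ∫ t, Ψ t (cfc (fun x => ∑ k, c k * b k x) (X t)) ∂μ := by
      intro c
      simp_rw [← integral_smul]
      refine (integral_finsetSum _ fun k _ => (hint k).smul (c k)).symm.trans ?_
      refine integral_congr_ae (.of_forall fun t => ?_)
      simp only [cfc_sum_mul c b hbc, map_sum, PositiveLinearMap.map_smul_of_tower, Pi.smul_apply]
    have hintc : ∀ c : Fin n → ℝ,
        Integrable (fun t => Ψ t (cfc (fun x => ∑ k, c k * b k x) (X t))) μ := by
      intro c
      simp only [cfc_sum_mul c b hbc, map_sum, PositiveLinearMap.map_smul_of_tower]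
      exact integrable_finsetSum _ fun k _ => (hint k).smul (c k)
    -- The index `none` carries the completing mass `P`, placed at the node `w`.
    let E : Option (Fin n) → K →L[ℂ] K :=
      fun o => o.elim P fun k => ∫ t, Ψ t (cfc (b k) (X t)) ∂μ
    let W : Option (Fin n) → ℝ := fun o => o.elim w v
    have hE : ∀ o, 0 ≤ E o := by
      rintro (_ | k)
      · exact hP
      · exact integral_nonneg_of_ae (hXpq.mono fun t ht =>
          (Ψ t).map_nonneg (cfc_nonneg fun x hx => (hb x (ht hx)).1 k))
    have hW : ∀ o, W o ∈ J := by
      rintro (_ | k)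
      · exact hw
      · exact hpqJ (hv k)
    have hE1 : ∑ o, E o = 1 := by
      have : ∑ k, ∫ t, Ψ t (cfc (b k) (X t)) ∂μ = ∫ t, Ψ t 1 ∂μ := by
        have := hsumint fun _ => 1
        simp only [one_smul, one_mul] at this
        rw [this]
        refine integral_congr_ae (hXpq.mono fun t ht => ?_)
        change Ψ t _ = Ψ t 1
        rw [cfc_congr (g := fun _ => 1) (fun x hx => (hb x (ht hx)).2.1), cfc_const_one ℝ (X t)]
      rw [Fintype.sum_option, ← hsum, add_comm]
      exact congrArg (· + P) this
    have hEX : ∑ o, W o • E o = ∫ t, Ψ t (X t) ∂μ + w • P := by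
      rw [Fintype.sum_option, add_comm]
      refine congrArg (· + w • P) ((hsumint v).trans ?_)
      refine integral_congr_ae (hXpq.mono fun t ht => ?_)
      change Ψ t _ = Ψ t _
      rw [cfc_congr (g := fun x => x) (fun x hx => (hb x (ht hx)).2.2.1), cfc_id' ℝ (X t)]
    have hEf : ∑ o, f (W o) • E o ≤
        ∫ t, Ψ t (cfc f (X t)) ∂μ + f w • P + ε • ∫ t, Ψ t 1 ∂μ := by
      rw [Fintype.sum_option, add_right_comm, add_comm]
      refine add_le_add_left ((hsumint fun k => f (v k)).trans_le ?_) _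
      rw [← integral_smul]
      refine le_of_le_of_eq ?_ (integral_add hfX (h1.smul ε))
      refine integral_mono_ae (hintc _) (hfX.add (h1.smul ε)) (hXpq.mono fun t ht => ?_)
      have hcont := hfc.mono ht
      change Ψ t _ ≤ Ψ t _ + ε • Ψ t 1
      rw [← PositiveLinearMap.map_smul_of_tower, ← map_add]
      refine OrderHomClass.mono (Ψ t) ?_
      have e : cfc f (X t) + ε • 1 = cfc (fun x => f x + ε) (X t) := by
        rw [cfc_add_const ε f (X t) hcont (hXsa t), Algebra.algebraMap_eq_smul_one]
      rw [e]
      exact cfc_mono (fun x hx => (hb x (ht hx)).2.2.2)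
        (continuous_finsetSum _ fun k _ => continuous_const.mul (hbc k)).continuousOn
        (hcont.add continuousOn_const)
    refine ⟨hEX ▸ spectrum_sum_smul_subset hf.1 hE hE1 hW, ?_⟩
    rw [← hEX]
    exact (hf.cfc_sum_smul_le hE hE1 hW).trans hEf
  refine ⟨(key 1 one_pos).1, ?_⟩
  have lim : Tendsto (fun ε : ℝ => ∫ t, Ψ t (cfc f (X t)) ∂μ + f w • P + ε • ∫ t, Ψ t 1 ∂μ)
      (𝓝[>] 0) (𝓝 (∫ t, Ψ t (cfc f (X t)) ∂μ + f w • P)) := by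
    have : Continuous fun ε : ℝ =>
        ∫ t, Ψ t (cfc f (X t)) ∂μ + f w • P + ε • ∫ t, Ψ t 1 ∂μ := by fun_prop
    have := (this.tendsto 0).mono_left (nhdsWithin_le_nhds (s := Set.Ioi 0))
    rwa [zero_smul, add_zero] at this
  exact ge_of_tendsto lim (eventually_mem_nhdsWithin.mono fun ε hε => (key ε hε).2)

variable [OpensMeasurableSpace T]

/-- Each spectrum lies strictly above `x`, but with no uniform gap. The sets where `X t ≥ r n`, with
`r n > x`, increase to `T`, so one of them leaves out mass at most 1/2. There the gap is uniform,
and on the rest `X t ≥ x` suffices. -/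
theorem exists_add_smul_le_integral_add {Ψ : T → A →ₚ[ℂ] B}
    (h1 : Integrable (fun t => Ψ t 1) μ) {X : T → A} (hX : Continuous X)
    (hXsa : ∀ t, IsSelfAdjoint (X t)) (hΨX : Integrable (fun t => Ψ t (X t)) μ) {x : ℝ}
    (hXx : ∀ t, spectrum ℝ (X t) ⊆ Set.Ioi x) {P : B} (hP : 0 ≤ P)
    (hsum : ∫ t, Ψ t 1 ∂μ + P = 1) {w : ℝ} (hw : x < w) :
    ∃ δ > 0, (x + δ) • (1 : B) ≤ ∫ t, Ψ t (X t) ∂μ + w • P := by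
  -- Capping at `w` makes the same lower bound available for the term `w • P`.
  let r : ℕ → ℝ := fun n => min (x + 1 / (n + 1)) w
  have hr : ∀ n, x < r n := fun n => lt_min (by linarith [Nat.one_div_pos_of_nat (α := ℝ) (n := n)]) hw
  let s : ℕ → Set T := fun n => {t | r n • (1 : A) ≤ X t}
  have hs : ∀ n, MeasurableSet (s n) := fun n =>
    (isClosed_le continuous_const hX).measurableSet
  have hmono : Monotone s := by
    intro m n hmn t ht
    refine le_trans (smul_le_smul_of_nonneg_right ?_ zero_le_one) ht
    exact min_le_min_right _ (by linarith [Nat.one_div_le_one_div (α := ℝ) hmn])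
  have hunion : ⋃ n, s n = Set.univ := by
    refine Set.eq_univ_of_forall fun t => Set.mem_iUnion.2 ?_
    obtain ⟨c, hxc, hc⟩ : ∃ c > x, ∀ y ∈ spectrum ℝ (X t), c ≤ y := by
      rcases (spectrum ℝ (X t)).eq_empty_or_nonempty with h | h
      · exact ⟨x + 1, by linarith, by simp [h]⟩
      · obtain ⟨c, hc⟩ := (spectrum.isCompact (𝕜 := ℝ) (X t)).exists_isLeast h
        exact ⟨c, hXx t hc.1, fun y hy => hc.2 hy⟩
    obtain ⟨n, hn⟩ := exists_nat_one_div_lt (sub_pos.2 hxc)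
    refine ⟨n, ?_⟩
    change r n • (1 : A) ≤ X t
    rw [← Algebra.algebraMap_eq_smul_one, algebraMap_le_iff_le_spectrum (ha := hXsa t)]
    intro y hy
    exact (min_le_left _ _).trans (by linarith [hc y hy])
  have hlim : Tendsto (fun n => ∫ t in s n, Ψ t 1 ∂μ) atTop (𝓝 (∫ t, Ψ t 1 ∂μ)) := by
    have := tendsto_setIntegral_of_monotone hs hmono (f := fun t => Ψ t 1) (μ := μ)
      (by rw [hunion]; exact h1.integrableOn)
    rwa [hunion, setIntegral_univ] at this
  -- Any bound below 1 on the remaining mass would do; 1/2 yields the final gap `(r n - x) / 2`.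
  obtain ⟨n, hn⟩ := (Metric.tendsto_atTop.1 hlim (1 / 2) (by norm_num)).imp fun n h => h n le_rfl
  have hsmall : ∫ t in (s n)ᶜ, Ψ t 1 ∂μ ≤ (1 / 2 : ℝ) • 1 := by
    have hadd := integral_add_compl (hs n) h1
    have hnorm : ‖∫ t in (s n)ᶜ, Ψ t 1 ∂μ‖ ≤ 1 / 2 := by
      rw [dist_comm, dist_eq_norm, ← hadd, add_sub_cancel_left] at hn
      exact hn.le
    have h0 : 0 ≤ ∫ t in (s n)ᶜ, Ψ t 1 ∂μ :=
      integral_nonneg fun t => (Ψ t).map_nonneg zero_le_one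
    rw [← Algebra.algebraMap_eq_smul_one]
    exact (CStarAlgebra.norm_le_iff_le_algebraMap _ (by norm_num) h0).1 hnorm
  refine ⟨(r n - x) / 2, by linarith [hr n], ?_⟩
  have hXx' : ∀ t, x • (1 : A) ≤ X t := fun t => by
    rw [← Algebra.algebraMap_eq_smul_one, algebraMap_le_iff_le_spectrum (ha := hXsa t)]
    exact fun y hy => le_of_lt (hXx t hy)
  have i1 : r n • ∫ t in s n, Ψ t 1 ∂μ ≤ ∫ t in s n, Ψ t (X t) ∂μ := by
    rw [← integral_smul]
    refine setIntegral_mono_on (h1.smul (r n)).integrableOn hΨX.integrableOn (hs n) fun t ht => ?_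
    rw [← PositiveLinearMap.map_smul_of_tower]
    exact OrderHomClass.mono (Ψ t) ht
  have i2 : x • ∫ t in (s n)ᶜ, Ψ t 1 ∂μ ≤ ∫ t in (s n)ᶜ, Ψ t (X t) ∂μ := by
    rw [← integral_smul]
    refine setIntegral_mono_on (h1.smul x).integrableOn hΨX.integrableOn (hs n).compl
      fun t ht => ?_
    rw [← PositiveLinearMap.map_smul_of_tower]
    exact OrderHomClass.mono (Ψ t) (hXx' t)
  have i3 : r n • P ≤ w • P := smul_le_smul_of_nonneg_right (min_le_right _ _) hP
  have hone : ∫ t in s n, Ψ t 1 ∂μ + ∫ t in (s n)ᶜ, Ψ t 1 ∂μ + P = 1 := by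
    rw [integral_add_compl (hs n) h1, hsum]
  have i4 : 0 ≤ (r n - x) • ((1 / 2 : ℝ) • (1 : B) - ∫ t in (s n)ᶜ, Ψ t 1 ∂μ) :=
    smul_nonneg (by linarith [hr n]) (sub_nonneg.2 hsmall)
  rw [← integral_add_compl (hs n) hΨX]
  set Q := ∫ t in (s n)ᶜ, Ψ t 1 ∂μ
  set R := ∫ t in s n, Ψ t 1 ∂μ
  calc (x + (r n - x) / 2) • (1 : B)
      ≤ (x + (r n - x) / 2) • (1 : B) + (r n - x) • ((1 / 2 : ℝ) • (1 : B) - Q) :=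
        le_add_of_nonneg_right i4
    _ = r n • (R + Q + P) - (r n - x) • Q := by rw [hone]; module
    _ = r n • R + x • Q + r n • P := by module
    _ ≤ _ := add_le_add (add_le_add i1 i2) i3

/-- A point `x` outside the interval `J` has all of `J` strictly on the side of `w`, so the uniform
gap just obtained, for `X` or for `-X`, keeps `x` out of the spectrum. -/
theorem spectrum_integral_add_subset {Ψ : T → A →ₚ[ℂ] B}
    (h1 : Integrable (fun t => Ψ t 1) μ) {X : T → A} (hX : Continuous X)
    (hXsa : ∀ t, IsSelfAdjoint (X t)) (hΨX : Integrable (fun t => Ψ t (X t)) μ) {J : Set ℝ}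
    (hJ : J.OrdConnected) (hXJ : ∀ t, spectrum ℝ (X t) ⊆ J) {P : B} (hP : 0 ≤ P)
    (hsum : ∫ t, Ψ t 1 ∂μ + P = 1) {w : ℝ} (hw : w ∈ J) :
    spectrum ℝ (∫ t, Ψ t (X t) ∂μ + w • P) ⊆ J := by
  have hsa : IsSelfAdjoint (∫ t, Ψ t (X t) ∂μ + w • P) :=
    (isSelfAdjoint_integral fun t => (hXsa t).map (Ψ t)).add
      ((IsSelfAdjoint.all w).smul hP.isSelfAdjoint)
  intro x hx
  by_contra hxJ
  rcases lt_trichotomy x w with h | rfl | h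
  · obtain ⟨δ, hδ, hle⟩ := exists_add_smul_le_integral_add h1 hX hXsa hΨX (x := x)
      (fun t y hy => lt_of_not_ge fun hyx => hxJ (hJ.out (hXJ t hy) hw ⟨hyx, h.le⟩)) hP hsum h
    exact hsa.notMem_spectrum_of_add_smul_le hδ hle hx
  · exact hxJ hw
  · obtain ⟨δ, hδ, hle⟩ := exists_add_smul_le_integral_add h1 hX.neg (fun t => (hXsa t).neg)
      (by simp only [Pi.neg_apply, map_neg]; exact hΨX.neg) (x := -x)
      (fun t y hy => by
        rw [Pi.neg_apply, ← spectrum.neg_eq, Set.mem_neg] at hy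
        have : -y < x := lt_of_not_ge fun hyx => hxJ (hJ.out hw (hXJ t hy) ⟨h.le, hyx⟩)
        exact neg_lt.1 this) hP hsum (neg_lt_neg h)
    refine hsa.neg.notMem_spectrum_of_add_smul_le (x := -x) hδ (hle.trans_eq ?_) ?_
    · simp only [Pi.neg_apply, map_neg, integral_neg, neg_smul, neg_add]
    · rw [← spectrum.neg_eq]
      simpa using hx

/-- **Jensen's operator inequality** for an integral of positive maps, completed to a unital one by
a scalar node `w`. -/
theorem OperatorConvexOn.jensen_integral {K : Type u} [NormedAddCommGroup K]
    [InnerProductSpace ℂ K] [CompleteSpace K] {J : Set ℝ} {f : ℝ → ℝ}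
    (hf : OperatorConvexOn.{u} J f) {Ψ : T → A →ₚ[ℂ] (K →L[ℂ] K)}
    (hmeas : ∀ Y : T → A, Continuous Y → AEStronglyMeasurable (fun t => Ψ t (Y t)) μ)
    (h1 : Integrable (fun t => Ψ t 1) μ) {X : T → A} (hX : Continuous X)
    (hXsa : ∀ t, IsSelfAdjoint (X t)) (hXJ : ∀ t, spectrum ℝ (X t) ⊆ J)
    (hΨX : Integrable (fun t => Ψ t (X t)) μ)
    (hfX : Integrable (fun t => Ψ t (cfc f (X t))) μ) {P : K →L[ℂ] K} (hP : 0 ≤ P)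
    (hsum : ∫ t, Ψ t 1 ∂μ + P = 1) {w : ℝ} (hw : w ∈ J) :
    spectrum ℝ (∫ t, Ψ t (X t) ∂μ + w • P) ⊆ J ∧
      cfc f (∫ t, Ψ t (X t) ∂μ + w • P) ≤ ∫ t, Ψ t (cfc f (X t)) ∂μ + f w • P := by
  have hspec := spectrum_integral_add_subset h1 hX hXsa hΨX hf.1 hXJ hP hsum hw
  refine ⟨hspec, ?_⟩
  obtain ⟨p, q, hp, hq, hpq, hexh⟩ := exists_monotone_Icc_exhaustion hf.1 hw
  let s : ℕ → Set T := fun n => {t | p n • (1 : A) ≤ X t ∧ X t ≤ q n • (1 : A)}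
  have hs : ∀ n, MeasurableSet (s n) := fun n =>
    ((isClosed_le continuous_const hX).inter (isClosed_le hX continuous_const)).measurableSet
  have hmono : Monotone s := fun m n hmn t ht =>
    ⟨(smul_le_smul_of_nonneg_right (hp hmn) zero_le_one).trans ht.1,
      ht.2.trans (smul_le_smul_of_nonneg_right (hq hmn) zero_le_one)⟩
  have hunion : ⋃ n, s n = Set.univ := by
    refine Set.eq_univ_of_forall fun t => Set.mem_iUnion.2 ?_
    obtain ⟨a, b, hS, hab⟩ : ∃ a b, spectrum ℝ (X t) ⊆ Set.Icc a b ∧ a ∈ J ∧ b ∈ J := by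
      rcases (spectrum ℝ (X t)).eq_empty_or_nonempty with h | h
      · exact ⟨w, w, by simp [h], hw, hw⟩
      · obtain ⟨a, ha⟩ := (spectrum.isCompact (𝕜 := ℝ) (X t)).exists_isLeast h
        obtain ⟨b, hb⟩ := (spectrum.isCompact (𝕜 := ℝ) (X t)).exists_isGreatest h
        exact ⟨a, b, fun y hy => ⟨ha.2 hy, hb.2 hy⟩, hXJ t ha.1, hXJ t hb.1⟩
    obtain ⟨n, hn1, hn2⟩ := ((hexh a hab.1).and (hexh b hab.2)).exists
    exact ⟨n, (hXsa t).spectrum_subset_Icc_iff.1 (hS.trans (Set.Icc_subset_Icc hn1.1 hn2.2))⟩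
  have hlim : ∀ G : T → K →L[ℂ] K, Integrable G μ →
      Tendsto (fun n => ∫ t in s n, G t ∂μ) atTop (𝓝 (∫ t, G t ∂μ)) := by
    intro G hG
    have := tendsto_setIntegral_of_monotone hs hmono (f := G) (μ := μ)
      (by rw [hunion]; exact hG.integrableOn)
    rwa [hunion, setIntegral_univ] at this
  -- Mass missing from `s n` is moved to the node `w` along with `P`, so the bounded case applies to
  -- each restriction.
  let R : ℕ → K →L[ℂ] K := fun n => 1 - ∫ t in s n, Ψ t 1 ∂μ
  have hR : ∀ n, 0 ≤ R n := fun n => by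
    refine sub_nonneg.2 ?_
    rw [← hsum, ← integral_add_compl (hs n) h1, add_assoc]
    exact le_add_of_nonneg_right
      (add_nonneg (integral_nonneg fun t => (Ψ t).map_nonneg zero_le_one) hP)
  have hRlim : Tendsto R atTop (𝓝 P) := by
    have := (hlim _ h1).const_sub 1
    rwa [← eq_sub_of_add_eq' hsum] at this
  have hn : ∀ n, spectrum ℝ (∫ t in s n, Ψ t (X t) ∂μ + w • R n) ⊆ J ∧
      cfc f (∫ t in s n, Ψ t (X t) ∂μ + w • R n) ≤
        ∫ t in s n, Ψ t (cfc f (X t)) ∂μ + f w • R n := fun n =>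
    hf.jensen_integral_of_bounded (fun Y hY => (hmeas Y hY).restrict) h1.restrict hX hXsa
      ((hpq n).2.2.1.trans (hpq n).2.2.2) (hf.1.out (hpq n).1 (hpq n).2.1)
      ((ae_restrict_mem (hs n)).mono fun t ht => (hXsa t).spectrum_subset_Icc_iff.2 ht)
      hfX.restrict (hR n) (add_sub_cancel _ _) hw
  have hLlim := (hlim _ hΨX).add (hRlim.const_smul w)
  have hsa : ∀ (ν : Measure T) (Q : K →L[ℂ] K), 0 ≤ Q →
      IsSelfAdjoint (∫ t, Ψ t (X t) ∂ν + w • Q) := fun ν Q hQ =>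
    (isSelfAdjoint_integral fun t => (hXsa t).map (Ψ t)).add
      ((IsSelfAdjoint.all w).smul hQ.isSelfAdjoint)
  exact le_of_tendsto_of_tendsto'
    (hLlim.cfc_of_ordConnected hf.1 hf.2.1 (fun n => hsa _ _ (hR n)) (fun n => (hn n).1)
      (hsa _ _ hP) hspec)
    ((hlim _ hfX).add (hRlim.const_smul (f w))) fun n => (hn n).2

end Integral

/-! ### Continuous fields of positive maps -/

/-- A continuous function on a space with a finite regular measure is almost everywhere strongly
measurable, with no countability assumption. -/
theorem Continuous.aestronglyMeasurable_of_regular {T E : Type*} [TopologicalSpace T] [T2Space T]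
    [MeasurableSpace T] [BorelSpace T] {μ : Measure T} [IsFiniteMeasure μ] [μ.Regular]
    [TopologicalSpace E] [TopologicalSpace.PseudoMetrizableSpace E] {g : T → E}
    (hg : Continuous g) : AEStronglyMeasurable g μ := by
  -- Inner regularity and finiteness give a σ-compact set of full measure; on each compact piece `g`
  -- has compact metrizable image.
  have hK : ∀ n : ℕ, ∃ K : Set T, IsCompact K ∧ μ Kᶜ < ((n : ENNReal) + 1)⁻¹ := fun n => by
    obtain ⟨K, -, hK, hlt⟩ := MeasurableSet.univ.exists_isCompact_sdiff_lt (measure_ne_top μ _)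
      (ε := ((n : ENNReal) + 1)⁻¹) (by simp)
    exact ⟨K, hK, by rwa [← Set.compl_eq_univ_sdiff] at hlt⟩
  choose K hKc hKlt using hK
  have hnull : μ (⋃ n, K n)ᶜ = 0 := by
    refine le_antisymm (ge_of_tendsto' (x := atTop) (f := fun n : ℕ => ((n : ENNReal) + 1)⁻¹)
      ?_ fun n => ?_) zero_le
    · have := ENNReal.tendsto_inv_nat_nhds_zero.comp (tendsto_add_atTop_nat 1)
      simpa [Function.comp_def] using this
    · exact (measure_mono (Set.compl_subset_compl.2 (Set.subset_iUnion K n))).trans (hKlt n).le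
  rw [← Measure.restrict_eq_self_of_ae_mem (μ := μ) (s := ⋃ n, K n) hnull]
  exact aestronglyMeasurable_iUnion_iff.2 fun n =>
    hg.continuousOn.aestronglyMeasurable_of_isCompact (hKc n) (hKc n).measurableSet

section PositiveMaps

variable {A B : Type*} [CStarAlgebra A] [PartialOrder A] [StarOrderedRing A]
  [CStarAlgebra B] [PartialOrder B] [StarOrderedRing B]

/-- Splitting `a` into four positive parts gives a crude constant, but one controlled by `‖Φ 1‖`;
this yields the local boundedness behind the joint continuity below. -/
theorem PositiveLinearMap.norm_apply_le_four_mul (Φ : A →ₚ[ℂ] B) (a : A) :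
    ‖Φ a‖ ≤ 4 * (‖Φ 1‖ * ‖a‖) := by
  obtain ⟨y, hy0, hy1, hy⟩ := CStarAlgebra.exists_sum_four_nonneg a
  have e : Φ a = ∑ i : Fin 4, Complex.I ^ (i : ℕ) • Φ (y i) := by
    conv_lhs => rw [hy]
    simp only [map_sum, map_smul]
  rw [e]
  refine (norm_sum_le _ _).trans ((Finset.sum_le_sum (g := fun _ => ‖Φ 1‖ * ‖a‖)
    fun i _ => ?_).trans (by simp))
  rw [norm_smul, norm_pow, Complex.norm_I, one_pow, one_mul]
  exact (Φ.norm_apply_le_of_nonneg _ (hy0 i)).trans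
    (mul_le_mul_of_nonneg_left (hy1 i) (norm_nonneg _))

theorem continuous_positiveLinearMap_apply {T : Type*} [TopologicalSpace T] {Φ : T → A →ₚ[ℂ] B}
    (hΦ : ∀ a, Continuous fun t => Φ t a) {Y : T → A} (hY : Continuous Y) :
    Continuous fun t => Φ t (Y t) := by
  refine continuous_iff_continuousAt.2 fun t₀ => ?_
  have h1 : Tendsto (fun t => Φ t (Y t - Y t₀)) (𝓝 t₀) (𝓝 0) := by
    refine squeeze_zero_norm (fun t => (Φ t).norm_apply_le_four_mul _) ?_
    have : Continuous fun t => 4 * (‖Φ t 1‖ * ‖Y t - Y t₀‖) :=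
      continuous_const.mul ((hΦ 1).norm.mul (hY.sub continuous_const).norm)
    simpa using this.tendsto t₀
  have h2 := h1.add ((hΦ (Y t₀)).tendsto t₀)
  simp only [map_sub, sub_add_cancel, zero_add] at h2
  exact h2

/-- The positive map `Y ↦ S Φ(q Y q) S` for self-adjoint `q`, `S`. -/
noncomputable def PositiveLinearMap.conjugate (Φ : A →ₚ[ℂ] B) {q : A} (hq : IsSelfAdjoint q) {S : B}
    (hS : IsSelfAdjoint S) : A →ₚ[ℂ] B :=
  PositiveLinearMap.mk₀
    (LinearMap.mulRight ℂ S ∘ₗ LinearMap.mulLeft ℂ S ∘ₗ Φ.toLinearMap ∘ₗ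
      LinearMap.mulRight ℂ q ∘ₗ LinearMap.mulLeft ℂ q)
    fun _ hx => hS.conjugate_nonneg (Φ.map_nonneg (hq.conjugate_nonneg hx))

end PositiveMaps

/-! ### Scalar consequences of operator convexity -/

theorem cfc_smul_one {A : Type*} [CStarAlgebra A] (f : ℝ → ℝ) (r : ℝ) :
    cfc f (r • (1 : A)) = f r • 1 := by
  rw [← Algebra.algebraMap_eq_smul_one, cfc_algebraMap, Algebra.algebraMap_eq_smul_one]

theorem smul_one_le_smul_one_iff {A : Type*} [CStarAlgebra A] [PartialOrder A] [StarOrderedRing A]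
    [Nontrivial A] {r s : ℝ} : r • (1 : A) ≤ s • 1 ↔ r ≤ s := by
  rw [← Algebra.algebraMap_eq_smul_one, ← Algebra.algebraMap_eq_smul_one,
    algebraMap_le_iff_le_spectrum (ha := IsSelfAdjoint.algebraMap A (.all s)), spectrum.scalar_eq]
  simp

theorem OperatorConvexOn.convexOn {K : Type u} [NormedAddCommGroup K] [InnerProductSpace ℂ K]
    [CompleteSpace K] [Nontrivial K] {J : Set ℝ} {f : ℝ → ℝ} (hf : OperatorConvexOn.{u} J f) :
    ConvexOn ℝ J f := by
  refine ⟨hf.1.convex, fun x hx y hy a b ha hb hab => ?_⟩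
  obtain rfl : b = 1 - a := by linarith
  have hspec : ∀ r ∈ J, spectrum ℝ (r • (1 : K →L[ℂ] K)) ⊆ J := fun r hr => by
    rw [← Algebra.algebraMap_eq_smul_one, spectrum.scalar_eq]
    simpa using hr
  have hsa : ∀ r : ℝ, IsSelfAdjoint (r • (1 : K →L[ℂ] K)) := fun r =>
    (IsSelfAdjoint.all r).smul (.one _)
  have := hf.2.2 K (x • 1) (y • 1) (hsa x) (hsa y) (hspec x hx) (hspec y hy) a ⟨ha, by linarith⟩
  rw [smul_smul, smul_smul, ← add_smul, cfc_smul_one, cfc_smul_one, cfc_smul_one, smul_smul,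
    smul_smul, ← add_smul, smul_one_le_smul_one_iff] at this
  exact this

/-- The slope is that of a chord: outside the chord's interval convexity keeps `f` above its line,
and inside compactness bounds the difference. For `f = -h` this bounds `h` above by an affine
function. -/
theorem ConvexOn.exists_affine_le_of_continuousOn {J : Set ℝ} {f : ℝ → ℝ} (hf : ConvexOn ℝ J f)
    (hfc : ContinuousOn f J) : ∃ a b : ℝ, ∀ x ∈ J, a + b * x ≤ f x := by
  rcases J.subsingleton_or_nontrivial with hJ | hJ
  · rcases J.eq_empty_or_nonempty with rfl | ⟨x, hx⟩
    · exact ⟨0, 0, by simp⟩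
    · exact ⟨f x, 0, fun y hy => by rw [hJ hy hx]; simp⟩
  obtain ⟨x₀, h₀, x₁, h₁, hlt⟩ := hJ.exists_lt
  have hd : 0 < x₁ - x₀ := sub_pos.2 hlt
  set d := (f x₁ - f x₀) / (x₁ - x₀) with hddef
  have hdmul : d * (x₁ - x₀) = f x₁ - f x₀ := div_mul_cancel₀ _ hd.ne'
  have hI : Set.Icc x₀ x₁ ⊆ J := hf.1.ordConnected.out h₀ h₁
  obtain ⟨m, hm⟩ := (isCompact_Icc.image_of_continuousOn
    ((hfc.mono hI).sub (continuousOn_const.mul continuousOn_id :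
      ContinuousOn (fun x => d * x) (Set.Icc x₀ x₁)))).bddBelow
  refine ⟨min m (f x₀ - d * x₀), d, fun x hx => ?_⟩
  rcases lt_or_ge x x₀ with h | h
  · have := hf.secant_mono_aux1 hx h₁ h hlt
    have : (f x₀ - d * x₀ + d * x) * (x₁ - x₀) ≤ f x * (x₁ - x₀) := by
      linear_combination this + (x - x₀) * hdmul
    linarith [le_of_mul_le_mul_right this hd, min_le_right m (f x₀ - d * x₀)]
  rcases le_or_gt x x₁ with h' | h'
  · have := hm ⟨x, ⟨h, h'⟩, rfl⟩
    change m ≤ f x - d * x at this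
    linarith [min_le_left m (f x₀ - d * x₀)]
  · have := hf.secant_mono_aux1 h₀ hx hlt h'
    have : (f x₀ - d * x₀ + d * x) * (x₁ - x₀) ≤ f x * (x₁ - x₀) := by
      linear_combination this + (x - x₀) * hdmul
    linarith [le_of_mul_le_mul_right this hd, min_le_right m (f x₀ - d * x₀)]

/-! ### Perspectives -/

section Perspective

theorem continuousOn_inv_sqrt : ContinuousOn (fun x : ℝ => (√x)⁻¹) (Set.Ioi 0) :=
  Real.continuous_sqrt.continuousOn.inv₀ fun _ hx => (Real.sqrt_pos.2 hx).ne'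

variable {A : Type*} [CStarAlgebra A] {R : A}

theorem cfc_sqrt_mul_cfc_sqrt (hR : IsSelfAdjoint R) (hRs : spectrum ℝ R ⊆ Set.Ioi 0) :
    cfc Real.sqrt R * cfc Real.sqrt R = R := by
  rw [← cfc_mul Real.sqrt Real.sqrt R]
  conv_rhs => rw [← cfc_id' ℝ R]
  exact cfc_congr fun x hx => Real.mul_self_sqrt (le_of_lt (hRs hx))

theorem cfc_inv_sqrt_mul_cfc_sqrt (hR : IsSelfAdjoint R) (hRs : spectrum ℝ R ⊆ Set.Ioi 0) :
    cfc (fun x : ℝ => (√x)⁻¹) R * cfc Real.sqrt R = 1 := by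
  rw [← cfc_mul _ Real.sqrt R (continuousOn_inv_sqrt.mono hRs), ← cfc_one ℝ R]
  exact cfc_congr fun x hx => inv_mul_cancel₀ (Real.sqrt_pos.2 (hRs hx)).ne'

theorem cfc_sqrt_mul_cfc_inv_sqrt (hR : IsSelfAdjoint R) (hRs : spectrum ℝ R ⊆ Set.Ioi 0) :
    cfc Real.sqrt R * cfc (fun x : ℝ => (√x)⁻¹) R = 1 := by
  rw [cfc_commute_cfc, cfc_inv_sqrt_mul_cfc_sqrt hR hRs]

theorem isSelfAdjoint_perspectiveArg {L : A} (hL : IsSelfAdjoint L) :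
    IsSelfAdjoint (perspectiveArg L R) := by
  have := hL.conjugate (cfc (fun x : ℝ => (√x)⁻¹) R)
  rwa [(cfc_predicate (fun x : ℝ => (√x)⁻¹) R).star_eq] at this

theorem cfc_spectrum_subset_Ioi {J : Set ℝ} {h : ℝ → ℝ} (hc : ContinuousOn h J)
    (hpos : ∀ x ∈ J, 0 < h x) {D : A} (hD : IsSelfAdjoint D) (hDJ : spectrum ℝ D ⊆ J) :
    spectrum ℝ (cfc h D) ⊆ Set.Ioi 0 := by
  rw [cfc_map_spectrum (R := ℝ) h D hD (hc.mono hDJ)]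
  rintro _ ⟨x, hx, rfl⟩
  exact hpos x (hDJ hx)

end Perspective

/-! ### Jensen for concave functions and joint convexity of perspectives -/

section Field

variable {T : Type*} [TopologicalSpace T] [MeasurableSpace T] [OpensMeasurableSpace T]
  {μ : Measure T} {A : Type*} [CStarAlgebra A] [PartialOrder A] [StarOrderedRing A]
  {K : Type u} [NormedAddCommGroup K] [InnerProductSpace ℂ K] [CompleteSpace K]

/-- Jensen's inequality for a positive operator concave function along a subunital integral of
positive maps. -/
theorem OperatorConcaveOn.integral_le_cfc_integral [Nontrivial K] {J : Set ℝ} {h : ℝ → ℝ}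
    (hh : OperatorConcaveOn.{u} J h) (hpos : ∀ x ∈ J, 0 < h x) {Φ : T → A →ₚ[ℂ] (K →L[ℂ] K)}
    (hmeas : ∀ Y : T → A, Continuous Y → AEStronglyMeasurable (fun t => Φ t (Y t)) μ)
    (h1 : Integrable (fun t => Φ t 1) μ) (h1_le : ∫ t, Φ t 1 ∂μ ≤ 1) {X : T → A}
    (hX : Continuous X) (hXsa : ∀ t, IsSelfAdjoint (X t)) (hXJ : ∀ t, spectrum ℝ (X t) ⊆ J)
    (hΦX : Integrable (fun t => Φ t (X t)) μ)
    (hcase : 0 ∈ J ∨ ∫ t, Φ t 1 ∂μ = 1 ∨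
      (0 ∈ closure J ∧ spectrum ℝ (∫ t, Φ t (X t) ∂μ) ⊆ J)) :
    spectrum ℝ (∫ t, Φ t (X t) ∂μ) ⊆ J ∧ Integrable (fun t => Φ t (cfc h (X t))) μ ∧
      ∫ t, Φ t (cfc h (X t)) ∂μ ≤ cfc h (∫ t, Φ t (X t) ∂μ) := by
  have hhc : ContinuousOn h J := by
    simpa only [neg_neg] using hh.2.1.fun_neg
  -- Integrability is not assumed: `0 ≤ h(X t) ≤ -a - b X t` for an affine minorant `a + b x` of
  -- `-h`.
  have hint : Integrable (fun t => Φ t (cfc h (X t))) μ := by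
    obtain ⟨a, b, hab⟩ := (OperatorConvexOn.convexOn (K := K) hh).exists_affine_le_of_continuousOn
      hh.2.1
    refine ((h1.smul (-a)).add (hΦX.smul (-b))).mono
      (hmeas _ (hX.cfc_of_ordConnected hh.1 hhc hXsa hXJ)) (.of_forall fun t => ?_)
    refine CStarAlgebra.norm_le_norm_of_nonneg_of_le
      ((Φ t).map_nonneg (cfc_nonneg fun x hx => (hpos x (hXJ t hx)).le)) ?_
    change _ ≤ (-a) • Φ t 1 + (-b) • Φ t (X t)
    rw [← PositiveLinearMap.map_smul_of_tower, ← PositiveLinearMap.map_smul_of_tower, ← map_add]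
    refine OrderHomClass.mono (Φ t) ?_
    have e : (-a) • 1 + (-b) • X t = cfc (fun x => -a + -b * x) (X t) := by
      rw [cfc_const_add (-a) (fun x => -b * x) (X t), cfc_const_mul_id (-b) (X t),
        Algebra.algebraMap_eq_smul_one]
    rw [e]
    exact cfc_mono (fun x hx => by linarith [hab x (hXJ t hx)]) (hhc.mono (hXJ t))
  set P : K →L[ℂ] K := 1 - ∫ t, Φ t 1 ∂μ with hPdef
  have hP : 0 ≤ P := sub_nonneg.2 h1_le
  have hsum : ∫ t, Φ t 1 ∂μ + P = 1 := add_sub_cancel _ _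
  have hneg : ∀ t, Φ t (cfc (fun x => -h x) (X t)) = -Φ t (cfc h (X t)) := fun t => by
    rw [cfc_neg, map_neg]
  -- The extra term `h w • P` is positive and can be dropped.
  have jensen : ∀ w ∈ J, spectrum ℝ (∫ t, Φ t (X t) ∂μ + w • P) ⊆ J ∧
      ∫ t, Φ t (cfc h (X t)) ∂μ ≤ cfc h (∫ t, Φ t (X t) ∂μ + w • P) := by
    intro w hw
    obtain ⟨hs, hle⟩ := OperatorConvexOn.jensen_integral hh hmeas h1 hX hXsa hXJ hΦX
      (by simp only [hneg]; exact hint.neg) hP hsum hw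
    refine ⟨hs, ?_⟩
    simp only [hneg, integral_neg] at hle
    rw [cfc_neg, neg_smul, ← neg_add, neg_le_neg_iff] at hle
    exact (le_add_of_nonneg_right (smul_nonneg (hpos w hw).le hP)).trans hle
  have hsa : ∀ w : ℝ, IsSelfAdjoint (∫ t, Φ t (X t) ∂μ + w • P) := fun w =>
    (isSelfAdjoint_integral fun t => (hXsa t).map (Φ t)).add
      ((IsSelfAdjoint.all w).smul hP.isSelfAdjoint)
  have hsa0 : IsSelfAdjoint (∫ t, Φ t (X t) ∂μ) := isSelfAdjoint_integral fun t => (hXsa t).map (Φ t)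
  rcases hcase with h0 | hone | ⟨hcl, hspec⟩
  · obtain ⟨hs, hle⟩ := jensen 0 h0
    rw [zero_smul, add_zero] at hs hle
    exact ⟨hs, hint, hle⟩
  -- Here `P = 0`, so any node serves. If `J` were empty, the `X t` would have empty spectrum, which
  -- forces `A` to be trivial and the total mass to be 0.
  · obtain ⟨w, hw⟩ : J.Nonempty := by
      by_contra hJ
      rw [Set.not_nonempty_iff_eq_empty] at hJ
      have hzero : ∀ t, Φ t 1 = 0 := fun t => by
        have hsub : Subsingleton A := by
          by_contra hA
          rw [not_subsingleton_iff_nontrivial] at hA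
          obtain ⟨x, hx⟩ := ContinuousFunctionalCalculus.spectrum_nonempty (R := ℝ) (X t) (hXsa t)
          exact (hJ ▸ hXJ t hx : x ∈ (∅ : Set ℝ))
        rw [Subsingleton.elim (1 : A) 0, map_zero]
      simp only [hzero, integral_zero] at hone
      exact zero_ne_one hone
    obtain ⟨hs, hle⟩ := jensen w hw
    rw [hPdef, hone, sub_self, smul_zero, add_zero] at hs hle
    exact ⟨hs, hint, hle⟩
  · refine ⟨hspec, hint, ?_⟩
    -- The node 0 may be outside `J`; nodes of `J` tending to 0 replace it, and the assumed spectrum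
    -- of the limit permits passing to it.
    obtain ⟨w, hw, hlim⟩ := mem_closure_iff_seq_limit.1 hcl
    have hD : Tendsto (fun n => ∫ t, Φ t (X t) ∂μ + w n • P) atTop (𝓝 (∫ t, Φ t (X t) ∂μ)) := by
      have := (hlim.smul_const P).const_add (∫ t, Φ t (X t) ∂μ)
      rwa [zero_smul, add_zero] at this
    exact ge_of_tendsto' (hD.cfc_of_ordConnected hh.1 hhc (fun n => hsa (w n))
      (fun n => (jensen (w n) (hw n)).1) hsa0 hspec) fun n => (jensen (w n) (hw n)).2

/-- Joint convexity of the perspective along an integral of positive maps, with a second argument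
dominating the integral of the individual ones. -/
theorem OperatorConvexOn.operatorPerspective_integral_le {J : Set ℝ} {f : ℝ → ℝ}
    (hf : OperatorConvexOn.{u} J f) (hJ0 : 0 ∈ J) (hf0 : f 0 ≤ 0) {Φ : T → A →ₚ[ℂ] (K →L[ℂ] K)}
    (hmeas : ∀ Y : T → A, Continuous Y → AEStronglyMeasurable (fun t => Φ t (Y t)) μ)
    {L R : T → A} (hL : Continuous L) (hLsa : ∀ t, IsSelfAdjoint (L t)) (hR : Continuous R)
    (hRsa : ∀ t, IsSelfAdjoint (R t)) (hRpos : ∀ t, spectrum ℝ (R t) ⊆ Set.Ioi 0)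
    (hLJ : ∀ t, spectrum ℝ (perspectiveArg (L t) (R t)) ⊆ J)
    (hΦL : Integrable (fun t => Φ t (L t)) μ) (hΦR : Integrable (fun t => Φ t (R t)) μ)
    (hΦg : Integrable (fun t => Φ t (operatorPerspective f (L t) (R t))) μ)
    {Q : K →L[ℂ] K} (hQsa : IsSelfAdjoint Q) (hQpos : spectrum ℝ Q ⊆ Set.Ioi 0)
    (hQ : ∫ t, Φ t (R t) ∂μ ≤ Q) :
    spectrum ℝ (perspectiveArg (∫ t, Φ t (L t) ∂μ) Q) ⊆ J ∧
      operatorPerspective f (∫ t, Φ t (L t) ∂μ) Q ≤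
        ∫ t, Φ t (operatorPerspective f (L t) (R t)) ∂μ := by
  let S : K →L[ℂ] K := cfc (fun x : ℝ => (√x)⁻¹) Q
  let V : K →L[ℂ] K := cfc Real.sqrt Q
  have hS : IsSelfAdjoint S := cfc_predicate _ _
  have hV : IsSelfAdjoint V := cfc_predicate _ _
  have hSV : S * V = 1 := cfc_inv_sqrt_mul_cfc_sqrt hQsa hQpos
  have hVS : V * S = 1 := cfc_sqrt_mul_cfc_inv_sqrt hQsa hQpos
  have hVV : V * V = Q := cfc_sqrt_mul_cfc_sqrt hQsa hQpos
  let s : T → A := fun t => cfc (fun x : ℝ => (√x)⁻¹) (R t)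
  let v : T → A := fun t => cfc Real.sqrt (R t)
  have hv : ∀ t, IsSelfAdjoint (v t) := fun t => cfc_predicate _ _
  have hsv : ∀ t, s t * v t = 1 := fun t => cfc_inv_sqrt_mul_cfc_sqrt (hRsa t) (hRpos t)
  have hvs : ∀ t, v t * s t = 1 := fun t => cfc_sqrt_mul_cfc_inv_sqrt (hRsa t) (hRpos t)
  have hvv : ∀ t, v t * v t = R t := fun t => cfc_sqrt_mul_cfc_sqrt (hRsa t) (hRpos t)
  have hscont : Continuous s :=
    hR.cfc_of_ordConnected Set.ordConnected_Ioi continuousOn_inv_sqrt hRsa hRpos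
  have hvcont : Continuous v := hR.cfc_of_ordConnected Set.ordConnected_Ioi
    Real.continuous_sqrt.continuousOn hRsa hRpos
  let X : T → A := fun t => perspectiveArg (L t) (R t)
  have hX : Continuous X := (hscont.mul hL).mul hscont
  have hvX : ∀ t, v t * X t * v t = L t := fun t => by
    change v t * (s t * L t * s t) * v t = L t
    calc v t * (s t * L t * s t) * v t = (v t * s t) * L t * (s t * v t) := by
          simp only [mul_assoc]
      _ = L t := by rw [hvs, hsv, one_mul, mul_one]
  let Ψ : T → A →ₚ[ℂ] (K →L[ℂ] K) := fun t => (Φ t).conjugate (hv t) hS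
  have hΨ : ∀ t Y, Ψ t Y = S * Φ t (v t * Y * v t) * S := fun t Y => rfl
  have hΨ1 : ∀ t, Ψ t 1 = S * Φ t (R t) * S := fun t => by rw [hΨ, mul_one, hvv]
  have hΨX : ∀ t, Ψ t (X t) = S * Φ t (L t) * S := fun t => by rw [hΨ, hvX]
  have hΨf : ∀ t, Ψ t (cfc f (X t)) = S * Φ t (operatorPerspective f (L t) (R t)) * S :=
    fun t => rfl
  have hconj : ∀ {G : T → K →L[ℂ] K}, Integrable G μ →
      Integrable (fun t => S * G t * S) μ ∧ ∫ t, S * G t * S ∂μ = S * (∫ t, G t ∂μ) * S := by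
    intro G hG
    refine ⟨(hG.const_mul S).mul_const S, ?_⟩
    rw [integral_mul_const_of_integrable (hG.const_mul S), integral_const_mul_of_integrable hG]
  have hSQS : S * Q * S = 1 := by
    calc S * Q * S = (S * V) * (V * S) := by rw [← hVV]; simp only [mul_assoc]
      _ = 1 := by rw [hSV, hVS, one_mul]
  have hle1 : S * (∫ t, Φ t (R t) ∂μ) * S ≤ 1 := hSQS ▸ hS.conjugate_le_conjugate hQ
  -- The defect of `Ψ` from a unital field sits at the node 0, so it does not change the argument of
  -- `f` and contributes a nonpositive term.
  obtain ⟨hspec, hle⟩ := hf.jensen_integral (Ψ := Ψ) (X := X)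
    (P := 1 - S * (∫ t, Φ t (R t) ∂μ) * S)
    (fun Y hY => by
      simp only [hΨ]
      exact ((hmeas _ ((hvcont.mul hY).mul hvcont)).const_mul S).mul_const S)
    (by simp only [hΨ1]; exact (hconj hΦR).1) hX
    (fun t => isSelfAdjoint_perspectiveArg (hLsa t)) hLJ
    (by simp only [hΨX]; exact (hconj hΦL).1)
    (by simp only [hΨf]; exact (hconj hΦg).1) (sub_nonneg.2 hle1)
    (by simp only [hΨ1, (hconj hΦR).2]; exact add_sub_cancel _ _) hJ0
  simp only [hΨX, hΨf, (hconj hΦL).2, (hconj hΦg).2, zero_smul, add_zero] at hspec hle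
  refine ⟨hspec, ?_⟩
  have hle' := hle.trans (add_le_of_nonpos_right
    (smul_nonpos_of_nonpos_of_nonneg hf0 (sub_nonneg.2 hle1)))
  refine (hV.conjugate_le_conjugate hle').trans_eq ?_
  calc V * (S * (∫ t, Φ t (operatorPerspective f (L t) (R t)) ∂μ) * S) * V
      = (V * S) * (∫ t, Φ t (operatorPerspective f (L t) (R t)) ∂μ) * (S * V) := by
        simp only [mul_assoc]
    _ = _ := by rw [hVS, hSV, one_mul, mul_one]

end Field

/-! ### Closed star subalgebras -/

section StarSubalgebra

variable {A : Type*} [CStarAlgebra A] (S : StarSubalgebra ℂ A) [IsClosed (S : Set A)]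

theorem StarSubalgebra.real_spectrum_eq (a : S) : spectrum ℝ a = spectrum ℝ (a : A) := by
  ext r
  rw [spectrum.mem_iff, spectrum.mem_iff, ← S.coe_isUnit]
  rfl

theorem StarSubalgebra.coe_cfc (f : ℝ → ℝ) {a : S} (ha : IsSelfAdjoint a)
    (hf : ContinuousOn f (spectrum ℝ a)) : ((cfc f a : S) : A) = cfc f (a : A) :=
  StarAlgHomClass.map_cfc S.subtype f a hf continuous_subtype_val ha (ha.map S.subtype)

/-- The square root of an ambient-positive element of `S` is formed by functional calculus inside
`S`, so it belongs to `S`. -/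
instance StarSubalgebra.starOrderedRing [PartialOrder A] [StarOrderedRing A] :
    StarOrderedRing S :=
  StarOrderedRing.of_nonneg_iff' (fun h z => add_le_add_right (α := A) h z) fun x => by
    constructor
    · intro hx
      have hxA : 0 ≤ (x : A) := hx
      have hsa : IsSelfAdjoint x := Subtype.ext hxA.isSelfAdjoint.star_eq
      have hspec : ∀ r ∈ spectrum ℝ x, 0 ≤ r := fun r hr =>
        spectrum_nonneg_of_nonneg hxA (S.real_spectrum_eq x ▸ hr)
      refine ⟨cfc Real.sqrt x, ?_⟩
      rw [(cfc_predicate Real.sqrt x : IsSelfAdjoint _).star_eq, ← cfc_mul Real.sqrt Real.sqrt x]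
      conv_lhs => rw [← cfc_id' ℝ x]
      exact cfc_congr fun r hr => (Real.mul_self_sqrt (hspec r hr)).symm
    · rintro ⟨s, rfl⟩
      exact star_mul_self_nonneg (s : A)

variable {S}

theorem StarSubalgebra.coe_perspectiveArg {L R : S} (hR : IsSelfAdjoint R)
    (hRs : spectrum ℝ R ⊆ Set.Ioi 0) :
    ((perspectiveArg L R : S) : A) = perspectiveArg (L : A) (R : A) := by
  simp only [perspectiveArg, MulMemClass.coe_mul, S.coe_cfc _ hR (continuousOn_inv_sqrt.mono hRs)]

theorem StarSubalgebra.coe_operatorPerspective {f : ℝ → ℝ} {L R : S} (hL : IsSelfAdjoint L)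
    (hR : IsSelfAdjoint R) (hRs : spectrum ℝ R ⊆ Set.Ioi 0)
    (hf : ContinuousOn f (spectrum ℝ (perspectiveArg L R))) :
    ((operatorPerspective f L R : S) : A) = operatorPerspective f (L : A) (R : A) := by
  simp only [operatorPerspective, MulMemClass.coe_mul,
    S.coe_cfc _ hR Real.continuous_sqrt.continuousOn,
    S.coe_cfc f (isSelfAdjoint_perspectiveArg hL) hf, coe_perspectiveArg hR hRs]

end StarSubalgebra

/-! ### The inequality for operator algebras -/

section Main

variable {T : Type*} [TopologicalSpace T] [T2Space T] [MeasurableSpace T] [BorelSpace T]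
  {μ : Measure T} [IsFiniteMeasure μ] [μ.Regular]
  {A : Type*} [CStarAlgebra A] [PartialOrder A] [StarOrderedRing A]
  {K : Type u} [NormedAddCommGroup K] [InnerProductSpace ℂ K] [CompleteSpace K]
  {𝔅 : StarSubalgebra ℂ (K →L[ℂ] K)} [IsClosed (𝔅 : Set (K →L[ℂ] K))]

theorem StarSubalgebra.coe_integral {T : Type*} [MeasurableSpace T] {μ : Measure T}
    {A : Type*} [CStarAlgebra A] {S : StarSubalgebra ℂ A}
    [IsClosed (S : Set A)] {g : T → S} (hg : Integrable g μ) :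
    ((∫ t, g t ∂μ : S) : A) = ∫ t, (g t : A) ∂μ :=
  ((S.toSubalgebra.toSubmodule.subtypeL.restrictScalars ℝ).integral_comp_comm hg).symm

/-- Jensen's inequality lives in `K →L[ℂ] K`, so each `Φ t` is composed with the inclusion of `𝔅`.
Spectra, order, integrals and functional calculus agree on both sides, and the result descends to
`𝔅`. -/
theorem generalizedPerspective_integral_le {Φ : T → A →ₚ[ℂ] 𝔅}
    (hΦ : ∀ X : A, Continuous fun t => Φ t X) (hΦ1 : Integrable (fun t => Φ t 1) μ)
    (hΦ1_le : ∫ t, Φ t 1 ∂μ ≤ 1) {L R : T → A} (hL : Continuous L) (hR : Continuous R)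
    (hLsa : ∀ t, IsSelfAdjoint (L t)) (hRsa : ∀ t, IsSelfAdjoint (R t))
    (hΦL : Integrable (fun t => Φ t (L t)) μ) (hΦR : Integrable (fun t => Φ t (R t)) μ)
    {J : Set ℝ} {f : ℝ → ℝ} (hf : OperatorConvexOn.{u} J f) (hJ0 : 0 ∈ J) (hf0 : f 0 ≤ 0)
    {J' : Set ℝ} {h : ℝ → ℝ} (hh : OperatorConcaveOn.{u} J' h) (hpos : ∀ x ∈ J', 0 < h x)
    (hRJ : ∀ t, spectrum ℝ (R t) ⊆ J')
    (hLJ : ∀ t, spectrum ℝ (perspectiveArg (L t) (cfc h (R t))) ⊆ J)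
    (hΦg : Integrable (fun t => Φ t (generalizedPerspective f h (L t) (R t))) μ)
    (hcase : 0 ∈ J' ∨ ∫ t, Φ t 1 ∂μ = 1 ∨
      (0 ∈ closure J' ∧ spectrum ℝ (∫ t, Φ t (R t) ∂μ) ⊆ J')) :
    spectrum ℝ (∫ t, Φ t (R t) ∂μ) ⊆ J' ∧
      spectrum ℝ (perspectiveArg (∫ t, Φ t (L t) ∂μ) (cfc h (∫ t, Φ t (R t) ∂μ))) ⊆ J ∧
      generalizedPerspective f h (∫ t, Φ t (L t) ∂μ) (∫ t, Φ t (R t) ∂μ) ≤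
        ∫ t, Φ t (generalizedPerspective f h (L t) (R t)) ∂μ := by
  rcases subsingleton_or_nontrivial K with hK | hK
  · have : Subsingleton 𝔅 := ⟨fun x y => Subtype.ext (Subsingleton.elim _ _)⟩
    simp only [spectrum.of_subsingleton, Set.empty_subset, true_and]
    exact (Subsingleton.elim _ _).le
  have hhc : ContinuousOn h J' := by simpa only [neg_neg] using hh.2.1.fun_neg
  let ι : 𝔅 →ₚ[ℂ] (K →L[ℂ] K) :=
    PositiveLinearMap.mk₀ 𝔅.toSubalgebra.toSubmodule.subtype fun x hx => hx
  let Ψ : T → A →ₚ[ℂ] (K →L[ℂ] K) := fun t => ι.comp (Φ t)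
  have hι : Continuous ((↑) : 𝔅 → K →L[ℂ] K) := continuous_subtype_val
  have hmeas : ∀ Y : T → A, Continuous Y → AEStronglyMeasurable (fun t => Ψ t (Y t)) μ :=
    fun Y hY => (continuous_positiveLinearMap_apply
      (fun a => hι.comp (hΦ a)) hY).aestronglyMeasurable_of_regular
  have hint : ∀ {Y : T → A}, Integrable (fun t => Φ t (Y t)) μ →
      Integrable (fun t => Ψ t (Y t)) μ ∧
        ((∫ t, Φ t (Y t) ∂μ : 𝔅) : K →L[ℂ] K) = ∫ t, Ψ t (Y t) ∂μ := fun hY =>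
    ⟨(𝔅.toSubalgebra.toSubmodule.subtypeL.restrictScalars ℝ).integrable_comp hY,
      StarSubalgebra.coe_integral hY⟩
  have hDsa : IsSelfAdjoint (∫ t, Φ t (R t) ∂μ) := isSelfAdjoint_integral fun t => (hRsa t).map (Φ t)
  have hLsa' : IsSelfAdjoint (∫ t, Φ t (L t) ∂μ) := isSelfAdjoint_integral fun t => (hLsa t).map (Φ t)
  have hone : ((∫ t, Φ t 1 ∂μ : 𝔅) : K →L[ℂ] K) = ∫ t, Ψ t 1 ∂μ := (hint hΦ1).2
  obtain ⟨hDJ, hhint, hhle⟩ := hh.integral_le_cfc_integral hpos hmeas (hint hΦ1).1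
    (hone ▸ hΦ1_le) hR hRsa hRJ (hint hΦR).1 (by
      rw [← hone, ← (hint hΦR).2, ← 𝔅.real_spectrum_eq]
      exact hcase.imp_right (Or.imp_left fun e => congrArg Subtype.val e))
  rw [← (hint hΦR).2] at hhle
  rw [← (hint hΦR).2, ← 𝔅.real_spectrum_eq] at hDJ
  have hRpos : ∀ t, spectrum ℝ (cfc h (R t)) ⊆ Set.Ioi 0 := fun t =>
    cfc_spectrum_subset_Ioi hhc hpos (hRsa t) (hRJ t)
  have hQpos : spectrum ℝ (cfc h (∫ t, Φ t (R t) ∂μ)) ⊆ Set.Ioi 0 :=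
    cfc_spectrum_subset_Ioi hhc hpos hDsa hDJ
  have hQsa : IsSelfAdjoint (cfc h (∫ t, Φ t (R t) ∂μ)) := cfc_predicate _ _
  have hQcoe := 𝔅.coe_cfc h hDsa (hhc.mono hDJ)
  rw [← hQcoe] at hhle
  obtain ⟨hspec, hle⟩ := hf.operatorPerspective_integral_le hJ0 hf0 hmeas hL hLsa
    (hR.cfc_of_ordConnected hh.1 hhc hRsa hRJ) (fun t => cfc_predicate h (R t)) hRpos hLJ
    (hint hΦL).1 hhint (hint hΦg).1 (hQsa.map 𝔅.subtype)
    ((𝔅.real_spectrum_eq _).symm.trans_subset hQpos) hhle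
  rw [← (hint hΦL).2] at hspec hle
  have hspec' : spectrum ℝ
      (perspectiveArg (∫ t, Φ t (L t) ∂μ) (cfc h (∫ t, Φ t (R t) ∂μ))) ⊆ J := by
    rw [𝔅.real_spectrum_eq, StarSubalgebra.coe_perspectiveArg hQsa hQpos]
    exact hspec
  refine ⟨hDJ, hspec', ?_⟩
  rw [← Subtype.coe_le_coe, (hint hΦg).2, generalizedPerspective,
    StarSubalgebra.coe_operatorPerspective hLsa' hQsa hQpos (hf.2.1.mono hspec')]
  exact hle

end Main

theorem operatorConcaveOn_id_Ioi : OperatorConcaveOn.{u} (Set.Ioi 0) fun x => x := by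
  refine ⟨Set.ordConnected_Ioi, continuousOn_id.neg, ?_⟩
  intro H _ _ _ A B hA hB _ _ s _
  have hAB : IsSelfAdjoint (s • A + (1 - s) • B) :=
    ((IsSelfAdjoint.all s).smul hA).add ((IsSelfAdjoint.all (1 - s)).smul hB)
  have hneg : ∀ X : H →L[ℂ] H, IsSelfAdjoint X → cfc (fun x : ℝ => -x) X = -X := fun X hX =>
    cfc_neg_id (R := ℝ) (a := X) hX
  rw [hneg _ hAB, hneg _ hA, hneg _ hB, smul_neg, smul_neg, neg_add]
theorem theorem2p4
    -- a locally compact Hausdorff space with a bounded Radon measure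
    {T : Type*} [TopologicalSpace T] [LocallyCompactSpace T] [T2Space T]
    [MeasurableSpace T] [BorelSpace T]
    (μ : Measure T) [IsFiniteMeasure μ] [μ.Regular]
    -- C⋆-algebras of operators on complex Hilbert spaces
    {H K : Type u} [NormedAddCommGroup H] [InnerProductSpace ℂ H] [CompleteSpace H]
    [NormedAddCommGroup K] [InnerProductSpace ℂ K] [CompleteSpace K]
    (𝔄 : StarSubalgebra ℂ (H →L[ℂ] H)) (𝔅 : StarSubalgebra ℂ (K →L[ℂ] K))
    [IsClosed (𝔄 : Set (H →L[ℂ] H))] [IsClosed (𝔅 : Set (K →L[ℂ] K))]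
    -- a continuous field of positive linear maps
    (Φ : T → 𝔄 →ₚ[ℂ] 𝔅) (hΦ : ∀ X : 𝔄, Continuous fun t => Φ t X)
    (hΦ1 : Integrable (fun t => Φ t 1) μ) (hΦ1_le : ∫ t, Φ t 1 ∂μ ≤ 1)
    -- continuous fields of self-adjoint operators
    (A B : T → 𝔄) (hA : Continuous A) (hB : Continuous B)
    (hA_sa : ∀ t, IsSelfAdjoint (A t)) (hB_sa : ∀ t, IsSelfAdjoint (B t))
    (hΦA : Integrable (fun t => Φ t (A t)) μ) (hΦB : Integrable (fun t => Φ t (B t)) μ)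
    -- an operator convex function
    (J : Set ℝ) (f : ℝ → ℝ) (hf : OperatorConvexOn.{u} J f) (hJ0 : 0 ∈ J) (hf0 : f 0 ≤ 0) :
    -- the inequality for the generalized perspective
    (∀ (J' : Set ℝ) (h : ℝ → ℝ), OperatorConcaveOn.{u} J' h → (∀ x ∈ J', 0 < h x) →
      (∀ t, spectrum ℝ (B t) ⊆ J') →
      (∀ t, spectrum ℝ (perspectiveArg (A t) (cfc h (B t))) ⊆ J) →
      Integrable (fun t => Φ t (generalizedPerspective f h (A t) (B t))) μ →
      (0 ∈ J' ∨ ∫ t, Φ t 1 ∂μ = 1 ∨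
        (0 ∈ closure J' ∧ spectrum ℝ (∫ t, Φ t (B t) ∂μ) ⊆ J')) →
      spectrum ℝ (∫ t, Φ t (B t) ∂μ) ⊆ J' ∧
      spectrum ℝ (perspectiveArg (∫ t, Φ t (A t) ∂μ) (cfc h (∫ t, Φ t (B t) ∂μ))) ⊆ J ∧
      generalizedPerspective f h (∫ t, Φ t (A t) ∂μ) (∫ t, Φ t (B t) ∂μ) ≤
        ∫ t, Φ t (generalizedPerspective f h (A t) (B t)) ∂μ) ∧
    -- the inequality for the perspective
    ((∀ t, IsStrictlyPositive (B t)) →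
      (∀ t, spectrum ℝ (perspectiveArg (A t) (B t)) ⊆ J) →
      Integrable (fun t => Φ t (operatorPerspective f (A t) (B t))) μ →
      (∫ t, Φ t 1 ∂μ = 1 ∨ IsStrictlyPositive (∫ t, Φ t (B t) ∂μ)) →
      IsStrictlyPositive (∫ t, Φ t (B t) ∂μ) ∧
      spectrum ℝ (perspectiveArg (∫ t, Φ t (A t) ∂μ) (∫ t, Φ t (B t) ∂μ)) ⊆ J ∧
      operatorPerspective f (∫ t, Φ t (A t) ∂μ) (∫ t, Φ t (B t) ∂μ) ≤
        ∫ t, Φ t (operatorPerspective f (A t) (B t)) ∂μ) := by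
  refine ⟨fun J' h hh hpos hBJ hAJ hg hcase => generalizedPerspective_integral_le hΦ hΦ1 hΦ1_le hA hB
    hA_sa hB_sa hΦA hΦB hf hJ0 hf0 hh hpos hBJ hAJ hg hcase, fun hBpos hAJ hg hcase => ?_⟩
  have hDsa : IsSelfAdjoint (∫ t, Φ t (B t) ∂μ) :=
    isSelfAdjoint_integral fun t => (hB_sa t).map (Φ t)
  have hid : ∀ t, cfc (fun x : ℝ => x) (B t) = B t := fun t => cfc_id' ℝ (B t)
  have hidD : cfc (fun x : ℝ => x) (∫ t, Φ t (B t) ∂μ) = ∫ t, Φ t (B t) ∂μ := cfc_id' ℝ _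
  -- With `h(x) = x` on `(0, ∞)`, the point 0 lies in the closure, so strict positivity of the
  -- integral is exactly the third alternative.
  have hmain := generalizedPerspective_integral_le hΦ hΦ1 hΦ1_le hA hB hA_sa hB_sa hΦA hΦB hf hJ0
    hf0 operatorConcaveOn_id_Ioi (fun x hx => hx)
    (fun t => (hB_sa t).isStrictlyPositive_iff_spectrum.1 (hBpos t))
    (by simpa only [hid] using hAJ) (by simpa only [generalizedPerspective, hid] using hg)
    (Or.inr (hcase.imp_right fun hD => ⟨by rw [closure_Ioi]; exact Set.self_mem_Ici,
      hDsa.isStrictlyPositive_iff_spectrum.1 hD⟩))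
  simpa only [generalizedPerspective, hid, hidD, hDsa.isStrictlyPositive_iff_spectrum] using hmain
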